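/- Let $p\in C^1([0,1];(0,\infty))$, $r\in C^0([0,1];(0,\infty))$, $q\in C^0([0,1];\mathbb R)$ and let $a_1,a_2,b_1,b_2\in\mathbb R$ with $|a_1|+|a_2|>0$, $|b_1|+|b_2|>0$. Write $\|g\|_r=\big(\int_0^1 r(x)|g(x)|^2dx\big)^{1/2}$ and let $L^2_r(0,1)$ be the space of measurable functions on $[0,1]$ with finite $\|\cdot\|_r$. Let $A:D\to L^2_r(0,1)$ be the Sturm–Liouville operator $$(Ag)(x)=-\frac1{r(x)}\frac{d}{dx}\Big(p(x)\frac{dg}{dx}(x)\Big)+\frac{q(x)}{r(x)}g(x),$$ $$D=\{g\in H^2(0,1): b_1g(0)+b_2g'(0)=a_1g(1)+a_2g'(1)=0\}.$$ Let $\lambda_1<\lambda_2<\cdots$ be its eigenvalues and $\phi_n\in C^2([0,1])$, $\|\phi_n\|_r=1$, the corresponding eigenfunctions. Assume (H) $\sum_{n\ge N}\lambda_n^{-1}\max_{0\le x\le1}|\phi_n(x)|<\infty$ for some $N$ with $\lambda_N>0$, and that $A$ is exponentially stable, i.e. $\lambda_1>0$. *Inputs.* Below, $(\tau_i)_{i\ge0}$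 denotes a sequence $0=\tau_0<\tau_1<\cdots$ with $\tau_i\to+\infty$, and $I=[0,\infty)\setminus\{\tau_i : i\ge 0\}$; we write $g[t]=g(t,\cdot)$. A continuous $g:[0,1]\to\mathbb R$ is in $PC^1([0,1])$ if it has finite one-sided derivatives (from the right on $[0,1)$, from the left on $(0,1]$) and, outside a finite subset of $(0,1)$, is differentiable on $(0,1)$ with continuous derivative. A function $f:[0,\infty)\times[0,1]\to\mathbb R$ is of class GD if there is such a sequence $(\tau_i)$ so that for every $i\ge1$ there are $f_1,f_2\in C^0((\tau_{i-1},\tau_i)\times[0,1])$, $a\in PC^1([0,1])$, $b\in C^0([0,1])$, $c\in D\cap C^2([0,1])$ such that: $f_1[t]\in PC^1([0,1])$, $f_2[t]\in D\cap C^2([0,1])$ and $f[t]=f_1[t]+f_2[t]$ for all $t\in(\tau_{i-1},\tau_i)$; $\sup_{t\in(\tau_{i-1},\tau_i)}\int_0^1 r\,(|f_1[t]|^2+|f_2[t]|^2+|Af_2[t]|^2)\,dx<\infty$; $\partial_tf_1$ exists and is continuous on $(\tau_{i-1},\tau_i)\times[0,1]$; and, as $t\to\tau_i^-$, $f_1(t,x)\to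 a(x)$, $\partial_tf_1(t,x)\to b(x)$, $f_2(t,x)\to c(x)$ for every $x\in[0,1]$. A right continuous $d:[0,\infty)\to\mathbb R$ is of class GB if there is such a sequence $(\tau_i)$ with $d\in C^2(I)$, with finite left limits of $d,\dot d,\ddot d$ at each $\tau_i>0$, and with $\sup_{(\tau_i,\tau_{i+1})}|\dot d|<\infty$ for each $i\ge0$. *Solutions.* Let $u_0\in L^2_r(0,1)$, $f\in GD$, $d_0,d_1\in GB$. A solution is a mapping $u\in C^0([0,\infty);L^2_r(0,1))$ for which, with a sequence $(\tau_i)$ that serves for $f$, $d_0$ and $d_1$ in the definitions above: $u\in C^1(I\times[0,1])$; $u[t]\in C^2([0,1])$ for all $t>0$; for all $i\ge1$ and $x\in[0,1]$, as $t\to\tau_i^-$, $u(t,x)\to u(\tau_i,x)$, $\partial_xu(t,x)\to\partial_xu(\tau_i,x)$ and $\partial_tu(t,x)\to-(Au[\tau_i])(x)+\lim_{t\to\tau_i^-}f(t,x)$; $u(0,x)=u_0(x)$ for $x\in[0,1]$; $\partial_tu(t,x)+(Au[t])(x)=f(t,x)$ for $(t,x)\in I\times(0,1)$; and $b_1u(t,0)+b_2\partial_xu(t,0)=d_0(t)$,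 $a_1u(t,1)+a_2\partial_xu(t,1)=d_1(t)$ for $t\in I$. (Here $Ag$ is given by the differential expression above for every $g\in C^2([0,1])$.) **Theorem.** (a) The boundary value problem $(pv')'-qv=0$ on $[0,1]$ has exactly one solution $v=\tilde u\in C^2([0,1])$ with $b_1v(0)+b_2v'(0)=\sqrt{b_1^2+b_2^2}$, $a_1v(1)+a_2v'(1)=0$, and exactly one solution $v=\bar u\in C^2([0,1])$ with $b_1v(0)+b_2v'(0)=0$, $a_1v(1)+a_2v'(1)=\sqrt{a_1^2+a_2^2}$. The following series converge and the stated equalities hold: $$C_0:=\frac{p(0)}{b_1^2+b_2^2}\sqrt{\sum_{n=1}^\infty\frac1{\lambda_n^2}\big|b_1\phi_n'(0)-b_2\phi_n(0)\big|^2}=\frac{\|\tilde u\|_r}{\sqrt{b_1^2+b_2^2}},$$ $$C_1:=\frac{p(1)}{a_1^2+a_2^2}\sqrt{\sum_{n=1}^\infty\frac1{\lambda_n^2}\big|a_2\phi_n(1)-a_1\phi_n'(1)\big|^2}=\frac{\|\bar u\|_r}{\sqrt{a_1^2+a_2^2}}.$$ (b) For all $u_0\in L^2_r(0,1)$, $f\in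 GD$, $d_0,d_1\in GB$, every solution $u$ with initial condition $u_0$ and inputs $f,d_0,d_1$ satisfies, for all $\sigma\in[0,\lambda_1)$ and $t>0$, $$\begin{aligned}\|u[t]\|_r\le{}& e^{-\lambda_1t}\|u_0\|_r+\frac{\lambda_1}{\lambda_1-\sigma}C_0\sup_{0<s<t}\big(|d_0(s)|e^{-\sigma(t-s)}\big)+\frac{\lambda_1}{\lambda_1-\sigma}C_1\sup_{0<s<t}\big(|d_1(s)|e^{-\sigma(t-s)}\big)\\&+\frac1{\lambda_1-\sigma}\sup_{0<s<t}\big(\|f[s]\|_re^{-\sigma(t-s)}\big),\end{aligned}$$ where the suprema are finite; if $f[s]\notin L^2_r(0,1)$ at some of the exceptional times $s=\tau_i$, these times may be left out of the last supremum. -/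

import Mathlib

open Set Filter Topology MeasureTheory

noncomputable section

/-- The data of a regular Sturm-Liouville problem on `[0,1]`: coefficients
`p ∈ C¹([0,1];(0,∞))`, `r ∈ C⁰([0,1];(0,∞))`, `q ∈ C⁰([0,1];ℝ)` and real numbers
`a₁, a₂, b₁, b₂` of the boundary conditions. Values outside `[0,1]` are irrelevant. -/
structure SLData where
  p : ℝ → ℝ
  r : ℝ → ℝ
  q : ℝ → ℝ
  a₁ : ℝ
  a₂ : ℝ
  b₁ : ℝ
  b₂ : ℝ
  p_contDiffOn : ContDiffOn ℝ 1 p (Icc 0 1)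
  p_pos : ∀ x ∈ Icc (0 : ℝ) 1, 0 < p x
  r_continuousOn : ContinuousOn r (Icc 0 1)
  r_pos : ∀ x ∈ Icc (0 : ℝ) 1, 0 < r x
  q_continuousOn : ContinuousOn q (Icc 0 1)
  a_pos : 0 < |a₁| + |a₂|
  b_pos : 0 < |b₁| + |b₂|

/-- The spatial derivative on `[0,1]` (one-sided at the end points). -/
def dx (g : ℝ → ℝ) (x : ℝ) : ℝ := derivWithin g (Icc 0 1) x

/-- Membership in the Sobolev space `H²(0,1)`: `g` is continuously differentiable on `[0,1]` and
`g'` is the integral of a square-integrable function. -/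
def InH2 (g : ℝ → ℝ) : Prop :=
  ContDiffOn ℝ 1 g (Icc 0 1) ∧
  ∃ h : ℝ → ℝ, MemLp h 2 (volume.restrict (Icc 0 1)) ∧
    ∀ x ∈ Icc (0 : ℝ) 1, dx g x = dx g 0 + ∫ y in (0 : ℝ)..x, h y

/-- The class `PC¹([0,1])` of continuous, piecewise `C¹` functions. -/
def PiecewiseC1 (g : ℝ → ℝ) : Prop :=
  ContinuousOn g (Icc 0 1) ∧
  (∀ x ∈ Ico (0 : ℝ) 1, ∃ l, HasDerivWithinAt g l (Ici x) x) ∧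
  (∀ x ∈ Ioc (0 : ℝ) 1, ∃ l, HasDerivWithinAt g l (Iic x) x) ∧
  ∃ F : Finset ℝ, (F : Set ℝ) ⊆ Ioo 0 1 ∧
    (∀ x ∈ Ioo (0 : ℝ) 1 \ F, DifferentiableAt ℝ g x) ∧
    ContinuousOn (deriv g) (Ioo (0 : ℝ) 1 \ F)

/-- An increasing sequence of times `0 = τ₀ < τ₁ < ⋯` tending to `+∞`. -/
structure IsTimeSequence (τ : ℕ → ℝ) : Prop where
  zero : τ 0 = 0
  strictMono : StrictMono τ
  tendsto : Tendsto τ atTop atTop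

/-- `I = [0,∞) \ {τ₀, τ₁, …}`. -/
def regularTimes (τ : ℕ → ℝ) : Set ℝ := Ici 0 \ range τ

/-- Assumption (H) for the eigenvalues `lam` and eigenfunctions `φ`:
`∑_{n ≥ N} λₙ⁻¹ max_{0≤x≤1} |φₙ(x)| < ∞` for some `N` with `λ_N > 0`. -/
def AssumptionH (lam : ℕ → ℝ) (φ : ℕ → ℝ → ℝ) : Prop :=
  ∃ N : ℕ, 0 < lam N ∧
    Summable fun n : ℕ => (lam (N + n))⁻¹ * ⨆ x : Icc (0 : ℝ) 1, |φ (N + n) x|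

namespace SLData

variable (S : SLData)

/-- `g ∈ L²_r(0,1)`. -/
def MemL2 (g : ℝ → ℝ) : Prop :=
  AEStronglyMeasurable g (volume.restrict (Ioc 0 1)) ∧
  IntervalIntegrable (fun x => S.r x * g x ^ 2) volume 0 1

/-- The norm `‖g‖_r = (∫₀¹ r(x) |g(x)|² dx)^{1/2}`. -/
def norm (g : ℝ → ℝ) : ℝ := Real.sqrt (∫ x in (0 : ℝ)..1, S.r x * g x ^ 2)

/-- The differential expression
`(A g)(x) = -(1/r(x)) (p(x) g'(x))' + (q(x)/r(x)) g(x)`. -/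
def A (g : ℝ → ℝ) (x : ℝ) : ℝ :=
  -(1 / S.r x) * dx (fun y => S.p y * dx g y) x + S.q x / S.r x * g x

/-- The boundary expression at `x = 0`. -/
def bc0 (g : ℝ → ℝ) : ℝ := S.b₁ * g 0 + S.b₂ * dx g 0

/-- The boundary expression at `x = 1`. -/
def bc1 (g : ℝ → ℝ) : ℝ := S.a₁ * g 1 + S.a₂ * dx g 1

/-- The domain `D ⊆ H²(0,1)` of the operator. -/
def InDomain (g : ℝ → ℝ) : Prop := InH2 g ∧ S.bc0 g = 0 ∧ S.bc1 g = 0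

/-- `μ` is an eigenvalue of `A : D → L²_r(0,1)`. -/
def IsEigenvalue (μ : ℝ) : Prop :=
  ∃ g : ℝ → ℝ, S.InDomain g ∧ (∃ x ∈ Icc (0 : ℝ) 1, g x ≠ 0) ∧
    ∀ᵐ x ∂(volume.restrict (Ioo (0 : ℝ) 1)), S.A g x = μ * g x

/-- `lam 0 < lam 1 < ⋯` are all the eigenvalues of `A`, in increasing order, and `φ n ∈ C²([0,1])`
is a normalized eigenfunction for `lam n` (numbering starts at `0`). -/
structure IsEigensystem (lam : ℕ → ℝ) (φ : ℕ → ℝ → ℝ) : Prop where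
  strictMono : StrictMono lam
  isEigenvalue_iff : ∀ μ, S.IsEigenvalue μ ↔ ∃ n, lam n = μ
  contDiffOn : ∀ n, ContDiffOn ℝ 2 (φ n) (Icc 0 1)
  inDomain : ∀ n, S.InDomain (φ n)
  eigen : ∀ n, ∀ x ∈ Ioo (0 : ℝ) 1, S.A (φ n) x = lam n * φ n x
  normalized : ∀ n, S.norm (φ n) = 1

/-- `f` is of class GD with respect to the sequence of times `τ`. -/
def IsGDWith (τ : ℕ → ℝ) (f : ℝ → ℝ → ℝ) : Prop :=
  ∀ i : ℕ, ∃ (f₁ f₂ : ℝ → ℝ → ℝ) (a b c : ℝ → ℝ),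
    ContinuousOn (Function.uncurry f₁) (Ioo (τ i) (τ (i + 1)) ×ˢ Icc (0 : ℝ) 1) ∧
    ContinuousOn (Function.uncurry f₂) (Ioo (τ i) (τ (i + 1)) ×ˢ Icc (0 : ℝ) 1) ∧
    PiecewiseC1 a ∧ ContinuousOn b (Icc 0 1) ∧
    (S.InDomain c ∧ ContDiffOn ℝ 2 c (Icc 0 1)) ∧
    (∀ t ∈ Ioo (τ i) (τ (i + 1)), PiecewiseC1 (f₁ t) ∧
      (S.InDomain (f₂ t) ∧ ContDiffOn ℝ 2 (f₂ t) (Icc 0 1)) ∧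
      ∀ x ∈ Icc (0 : ℝ) 1, f t x = f₁ t x + f₂ t x) ∧
    (∃ M : ℝ, ∀ t ∈ Ioo (τ i) (τ (i + 1)),
      ∫ x in (0 : ℝ)..1, S.r x * (f₁ t x ^ 2 + f₂ t x ^ 2 + S.A (f₂ t) x ^ 2) ≤ M) ∧
    (∀ t ∈ Ioo (τ i) (τ (i + 1)), ∀ x ∈ Icc (0 : ℝ) 1,
      DifferentiableAt ℝ (fun s => f₁ s x) t) ∧
    ContinuousOn (fun z : ℝ × ℝ => deriv (fun s => f₁ s z.2) z.1)
      (Ioo (τ i) (τ (i + 1)) ×ˢ Icc (0 : ℝ) 1) ∧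
    ∀ x ∈ Icc (0 : ℝ) 1,
      Tendsto (fun t => f₁ t x) (𝓝[<] τ (i + 1)) (𝓝 (a x)) ∧
      Tendsto (fun t => deriv (fun s => f₁ s x) t) (𝓝[<] τ (i + 1)) (𝓝 (b x)) ∧
      Tendsto (fun t => f₂ t x) (𝓝[<] τ (i + 1)) (𝓝 (c x))

/-- The class GD of distributed inputs. -/
def IsGD (f : ℝ → ℝ → ℝ) : Prop := ∃ τ, IsTimeSequence τ ∧ S.IsGDWith τ f

end SLData

/-- `d` is of class GB with respect to the sequence of times `τ`. -/
def IsGBWith (τ : ℕ → ℝ) (d : ℝ → ℝ) : Prop :=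
  (∀ t, 0 ≤ t → ContinuousWithinAt d (Ici t) t) ∧
  ContDiffOn ℝ 2 d (regularTimes τ) ∧
  (∀ i, 0 < τ i →
    (∃ l, Tendsto d (𝓝[<] τ i) (𝓝 l)) ∧
    (∃ l, Tendsto (deriv d) (𝓝[<] τ i) (𝓝 l)) ∧
    (∃ l, Tendsto (deriv (deriv d)) (𝓝[<] τ i) (𝓝 l))) ∧
  ∀ i, ∃ M : ℝ, ∀ t ∈ Ioo (τ i) (τ (i + 1)), |deriv d t| ≤ M

/-- The class GB of boundary inputs. -/
def IsGB (d : ℝ → ℝ) : Prop := ∃ τ, IsTimeSequence τ ∧ IsGBWith τ d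

namespace SLData

variable (S : SLData)

/-- `u` is a solution of the evolution equation
`u_t = (1/r) (p u_x)_x - (q/r) u + f` with boundary conditions
`b₁ u(t,0) + b₂ u_x(t,0) = d₀(t)`, `a₁ u(t,1) + a₂ u_x(t,1) = d₁(t)` and initial condition `u₀`,
regular away from the times `τ`. -/
structure IsSolutionWith (τ : ℕ → ℝ) (u₀ : ℝ → ℝ) (f : ℝ → ℝ → ℝ) (d₀ d₁ : ℝ → ℝ)
    (u : ℝ → ℝ → ℝ) : Prop where
  memL2 : ∀ t, 0 ≤ t → S.MemL2 (u t)
  continuous_L2 : ∀ t, 0 ≤ t →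
    Tendsto (fun s => S.norm (fun x => u s x - u t x)) (𝓝[Ici 0] t) (𝓝 0)
  contDiffOn : ContDiffOn ℝ 1 (Function.uncurry u) (regularTimes τ ×ˢ Icc (0 : ℝ) 1)
  contDiffOn_profile : ∀ t, 0 < t → ContDiffOn ℝ 2 (u t) (Icc 0 1)
  left_limit : ∀ i, 1 ≤ i → ∀ x ∈ Icc (0 : ℝ) 1,
    Tendsto (fun t => u t x) (𝓝[<] τ i) (𝓝 (u (τ i) x))
  left_limit_dt : ∀ i, 1 ≤ i → ∀ x ∈ Icc (0 : ℝ) 1, ∃ l : ℝ,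
    Tendsto (fun t => f t x) (𝓝[<] τ i) (𝓝 l) ∧
    Tendsto (fun t => deriv (fun s => u s x) t) (𝓝[<] τ i) (𝓝 (-S.A (u (τ i)) x + l))
  left_limit_dx : ∀ i, 1 ≤ i → ∀ x ∈ Icc (0 : ℝ) 1,
    Tendsto (fun t => dx (u t) x) (𝓝[<] τ i) (𝓝 (dx (u (τ i)) x))
  initial : ∀ x ∈ Icc (0 : ℝ) 1, u 0 x = u₀ x
  pde : ∀ t ∈ regularTimes τ, ∀ x ∈ Ioo (0 : ℝ) 1,
    deriv (fun s => u s x) t + S.A (u t) x = f t x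
  boundary0 : ∀ t ∈ regularTimes τ, S.bc0 (u t) = d₀ t
  boundary1 : ∀ t ∈ regularTimes τ, S.bc1 (u t) = d₁ t

/-- `u` is a solution of the evolution equation with initial condition `u₀` corresponding to the
inputs `f`, `d₀`, `d₁`; the sequence of times is one that serves for all three inputs. -/
def IsSolution (u₀ : ℝ → ℝ) (f : ℝ → ℝ → ℝ) (d₀ d₁ : ℝ → ℝ) (u : ℝ → ℝ → ℝ) : Prop :=
  ∃ τ, IsTimeSequence τ ∧ S.IsGDWith τ f ∧ IsGBWith τ d₀ ∧ IsGBWith τ d₁ ∧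
    S.IsSolutionWith τ u₀ f d₀ d₁ u

/-- `v ∈ C²([0,1])` solves `(p v')' - q v = 0` on `[0,1]` with
`b₁ v(0) + b₂ v'(0) = β₀` and `a₁ v(1) + a₂ v'(1) = β₁`. -/
def SolvesBVP (β₀ β₁ : ℝ) (v : ℝ → ℝ) : Prop :=
  ContDiffOn ℝ 2 v (Icc 0 1) ∧
  (∀ x ∈ Icc (0 : ℝ) 1, dx (fun y => S.p y * dx v y) x - S.q x * v x = 0) ∧
  S.bc0 v = β₀ ∧ S.bc1 v = β₁

/-- `v` is the unique solution on `[0,1]` of the boundary value problem. -/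
def IsUniqueBVPSolution (β₀ β₁ : ℝ) (v : ℝ → ℝ) : Prop :=
  S.SolvesBVP β₀ β₁ v ∧ ∀ w, S.SolvesBVP β₀ β₁ w → EqOn w v (Icc 0 1)

/-- The terms of the series in `C₀`. -/
def gainTerm₀ (lam : ℕ → ℝ) (φ : ℕ → ℝ → ℝ) (n : ℕ) : ℝ :=
  1 / lam n ^ 2 * |S.b₁ * dx (φ n) 0 - S.b₂ * φ n 0| ^ 2

/-- The terms of the series in `C₁`. -/
def gainTerm₁ (lam : ℕ → ℝ) (φ : ℕ → ℝ → ℝ) (n : ℕ) : ℝ :=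
  1 / lam n ^ 2 * |S.a₂ * φ n 1 - S.a₁ * dx (φ n) 1| ^ 2

/-- The gain `C₀`. -/
def C₀ (lam : ℕ → ℝ) (φ : ℕ → ℝ → ℝ) : ℝ :=
  S.p 0 / (S.b₁ ^ 2 + S.b₂ ^ 2) * Real.sqrt (∑' n, S.gainTerm₀ lam φ n)

/-- The gain `C₁`. -/
def C₁ (lam : ℕ → ℝ) (φ : ℕ → ℝ → ℝ) : ℝ :=
  S.p 1 / (S.a₁ ^ 2 + S.a₂ ^ 2) * Real.sqrt (∑' n, S.gainTerm₁ lam φ n)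

end SLData

end

open Set Filter Topology MeasureTheory

noncomputable section

/-! ### Calculus on `[0,1]` -/

/-! The solution is expanded in the eigenfunctions, numbered from 0, so that λ₀ is the smallest
eigenvalue. For cₙ(t) = ∫ r φₙ u[t], Green's formula (`SLData.integral_mul_A`) turns the boundary
inputs into forcing terms: cₙ' = -λₙ cₙ + ∫ r φₙ f + βₙ d₀ - γₙ d₁, with βₙ = p(0) `trace₀` φₙ and
γₙ = p(1) `trace₁` φₙ. Each cₙ is continuous across the exceptional times, so this can be integrated
over [0, t] (`coeff_eq`).

Green's formula also gives the coefficients of the stationary solution with boundary value √(b₁² +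
b₂²) at 0: they are βₙ √(b₁² + b₂²) / λₙ. By Parseval C₀ is the ℓ² norm of βₙ / λₙ, and likewise C₁
that of γₙ / λₙ.

For the estimate (`norm_le`), the sum of cₙ(t)² over n < N is tested against itself. The initial
value and f are handled by Bessel's inequality and the slowest rate λ₀. The boundary terms are
integrated in time first, each mode with its own rate, since 1/(λₙ - σ) ≤ λ₀/(λ₀ - σ) · 1/λₙ;
Cauchy-Schwarz in n then produces C₀ and C₁. Parseval allows N → ∞.

Parseval rests on completeness. As 0 is not an eigenvalue, A has an inverse given by a continuous
Green's function. Conjugated with √r it becomes a compact, symmetric, injective operator on L²(0,1),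
whose eigenvectors are multiples of √r φₙ; the spectral theorem applies. -/

theorem uniqueDiffOn_unit : UniqueDiffOn ℝ (Icc (0 : ℝ) 1) := uniqueDiffOn_Icc zero_lt_one

theorem HasDerivWithinAt.dx_eq {g : ℝ → ℝ} {l x : ℝ} (h : HasDerivWithinAt g l (Icc 0 1) x)
    (hx : x ∈ Icc (0 : ℝ) 1) : dx g x = l :=
  h.derivWithin (uniqueDiffOn_unit x hx)

theorem ContDiffOn.hasDerivWithinAt_dx {g : ℝ → ℝ} {n : WithTop ℕ∞} (hg : ContDiffOn ℝ n g (Icc 0 1))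
    (hn : n ≠ 0) {x : ℝ} (hx : x ∈ Icc (0 : ℝ) 1) : HasDerivWithinAt g (dx g x) (Icc 0 1) x :=
  ((hg.differentiableOn hn) x hx).hasDerivWithinAt

theorem dx_congr {g h : ℝ → ℝ} (hgh : EqOn g h (Icc 0 1)) {x : ℝ} (hx : x ∈ Icc (0 : ℝ) 1) :
    dx g x = dx h x :=
  derivWithin_congr hgh (hgh hx)

theorem hasDerivWithinAt_integral_unit {f : ℝ → ℝ} (hf : ContinuousOn f (Icc 0 1)) {x : ℝ}
    (hx : x ∈ Icc (0 : ℝ) 1) :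
    HasDerivWithinAt (fun y => ∫ z in (0 : ℝ)..y, f z) (f x) (Icc 0 1) x := by
  -- Extending f by its end values makes it continuous on ℝ, so the fundamental theorem holds at the
  -- end points too.
  have hF : Continuous (IccExtend zero_le_one ((Icc (0 : ℝ) 1).domRestrict f)) :=
    hf.domRestrict.Icc_extend'
  have hEq : ∀ z ∈ Icc (0 : ℝ) 1, IccExtend zero_le_one ((Icc (0 : ℝ) 1).domRestrict f) z = f z :=
    fun z hz => by rw [IccExtend_of_mem _ _ hz]; rfl
  have h := (hF.integral_hasStrictDerivAt 0 x).hasDerivAt.hasDerivWithinAt (s := Icc 0 1)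
  rw [hEq x hx] at h
  refine h.congr_of_mem (fun y hy => ?_) hx
  refine intervalIntegral.integral_congr fun z hz => ?_
  rw [uIcc_of_le hy.1] at hz
  exact (hEq z ⟨hz.1, hz.2.trans hy.2⟩).symm

theorem integral_of_hasDerivWithinAt_unit {F f : ℝ → ℝ}
    (hF : ∀ x ∈ Icc (0 : ℝ) 1, HasDerivWithinAt F (f x) (Icc 0 1) x)
    (hf : ContinuousOn f (Icc 0 1)) : ∫ x in (0 : ℝ)..1, f x = F 1 - F 0 := by
  refine intervalIntegral.integral_eq_sub_of_hasDerivAt_of_le zero_le_one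
    (fun x hx => (hF x hx).continuousWithinAt)
    (fun x hx => (hF x (Ioo_subset_Icc_self hx)).hasDerivAt (Icc_mem_nhds hx.1 hx.2)) ?_
  exact ContinuousOn.intervalIntegrable (by rwa [uIcc_of_le zero_le_one])

/-! ### Linear initial value problems on `[0,1]` -/

/-- Truncation of a real number at level `R`. -/
def clip (R z : ℝ) : ℝ := max (-R) (min R z)

theorem abs_clip_le {R : ℝ} (hR : 0 ≤ R) (z : ℝ) : |clip R z| ≤ R :=
  abs_le.2 ⟨le_max_left _ _, max_le (by linarith) (min_le_left _ _)⟩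

theorem clip_of_abs_le {R z : ℝ} (h : |z| ≤ R) : clip R z = z := by
  obtain ⟨h1, h2⟩ := abs_le.1 h
  rw [clip, min_eq_right h2, max_eq_right h1]

theorem abs_clip_sub_clip_le (R y z : ℝ) : |clip R y - clip R z| ≤ |y - z| := by
  have h1 := abs_max_sub_max_le_max (-R) (min R y) (-R) (min R z)
  have h2 := abs_min_sub_min_le_max R y R z
  simp only [sub_self, abs_zero, abs_nonneg, sup_of_le_right] at h1 h2
  exact h1.trans h2

theorem abs_clip_le_abs {R : ℝ} (hR : 0 ≤ R) (z : ℝ) : |clip R z| ≤ |z| := by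
  have := abs_clip_sub_clip_le R z 0
  rwa [clip_of_abs_le (z := 0) (by simpa using hR), sub_zero, sub_zero] at this

theorem exists_bound_unit {f : ℝ → ℝ} (hf : ContinuousOn f (Icc 0 1)) :
    ∃ K, 0 ≤ K ∧ ∀ x ∈ Icc (0 : ℝ) 1, |f x| ≤ K := by
  obtain ⟨K, hK⟩ := isCompact_Icc.exists_bound_of_continuousOn hf
  exact ⟨|K|, abs_nonneg _, fun x hx => (hK x hx).trans (le_abs_self K)⟩

/-- Picard-Lindelöf is applied to a truncated vector field, which is bounded, so that the solution
exists on all of [0,1]. Gronwall's inequality then shows that the truncation is never active. -/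
theorem exists_linear_system {m c : ℝ → ℝ} (hm : ContinuousOn m (Icc 0 1))
    (hc : ContinuousOn c (Icc 0 1)) (α β : ℝ) :
    ∃ v w : ℝ → ℝ, v 0 = α ∧ w 0 = β ∧
      (∀ x ∈ Icc (0 : ℝ) 1, HasDerivWithinAt v (m x * w x) (Icc 0 1) x) ∧
      ∀ x ∈ Icc (0 : ℝ) 1, HasDerivWithinAt w (c x * v x) (Icc 0 1) x := by
  obtain ⟨K₁, hK₁, hmK⟩ := exists_bound_unit hm
  obtain ⟨K₂, hK₂, hcK⟩ := exists_bound_unit hc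
  set K := max K₁ K₂ with hK
  have hK0 : 0 ≤ K := hK₁.trans (le_max_left _ _)
  replace hmK : ∀ x ∈ Icc (0 : ℝ) 1, |m x| ≤ K := fun x hx => (hmK x hx).trans (le_max_left _ _)
  replace hcK : ∀ x ∈ Icc (0 : ℝ) 1, |c x| ≤ K := fun x hx => (hcK x hx).trans (le_max_right _ _)
  -- The Gronwall bound on [0,1] for a field of linear growth K.
  set R := ‖(α, β)‖ * Real.exp K with hRdef
  have hR : 0 ≤ R := by positivity
  set F : ℝ → ℝ × ℝ → ℝ × ℝ := fun t z => (m t * clip R z.2, c t * clip R z.1) with hFdef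
  -- The truncated field has norm at most K R, so within unit time a solution stays in the ball of
  -- radius K R around its initial value.
  have hPL : IsPicardLindelof F (tmin := 0) (tmax := 1) ⟨0, by simp⟩ (α, β)
      (Real.toNNReal (K * R)) 0 (Real.toNNReal (K * R)) (Real.toNNReal K) := by
    refine ⟨fun t ht => ?_, fun z _ => ?_, fun t ht z _ => ?_, ?_⟩
    · refine LipschitzWith.lipschitzOnWith (LipschitzWith.of_dist_le_mul fun y z => ?_)
      rw [Real.coe_toNNReal _ hK0, Prod.dist_eq, Prod.dist_eq]
      simp only [hFdef, Real.dist_eq, ← mul_sub, abs_mul]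
      refine max_le ?_ ?_
      · exact mul_le_mul (hmK t ht) ((abs_clip_sub_clip_le _ _ _).trans (le_max_right _ _))
          (abs_nonneg _) hK0
      · exact mul_le_mul (hcK t ht) ((abs_clip_sub_clip_le _ _ _).trans (le_max_left _ _))
          (abs_nonneg _) hK0
    · exact (hm.mul continuousOn_const).prodMk (hc.mul continuousOn_const)
    · rw [Real.coe_toNNReal _ (mul_nonneg hK0 hR)]
      simp only [hFdef, Prod.norm_def, Real.norm_eq_abs, abs_mul]
      exact max_le (mul_le_mul (hmK t ht) (abs_clip_le hR _) (abs_nonneg _) hK0)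
        (mul_le_mul (hcK t ht) (abs_clip_le hR _) (abs_nonneg _) hK0)
    · simp
  obtain ⟨z, hz0, hz⟩ := hPL.exists_eq_forall_mem_Icc_hasDerivWithinAt₀
  replace hz0 : z 0 = (α, β) := hz0
  -- Truncation does not increase absolute values, so the field still satisfies ‖F t z‖ ≤ K ‖z‖.
  have hbound : ∀ x ∈ Icc (0 : ℝ) 1, ‖z x‖ ≤ R := by
    intro x hx
    have h := norm_le_gronwallBound_of_norm_deriv_right_le (f := z) (f' := fun t => F t (z t))
      (δ := ‖(α, β)‖) (K := K) (ε := 0) (a := 0) (b := 1)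
      (fun y hy => (hz y hy).continuousWithinAt)
      (fun y hy => (hz y (Ico_subset_Icc_self hy)).mono_of_mem_nhdsWithin
        (mem_of_superset (Icc_mem_nhdsGE hy.2) (Icc_subset_Icc_left hy.1)))
      (by rw [hz0]) (fun y hy => ?_) x hx
    · rw [gronwallBound_ε0, sub_zero] at h
      refine h.trans ?_
      rw [hRdef]
      gcongr
      nlinarith [hx.2]
    · have hy' := Ico_subset_Icc_self hy
      rw [add_zero]
      simp only [hFdef, Prod.norm_def, Real.norm_eq_abs, abs_mul]
      exact max_le (mul_le_mul (hmK y hy') ((abs_clip_le_abs hR _).trans (le_max_right _ _))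
          (abs_nonneg _) hK0)
        (mul_le_mul (hcK y hy') ((abs_clip_le_abs hR _).trans (le_max_left _ _))
          (abs_nonneg _) hK0)
  refine ⟨fun x => (z x).1, fun x => (z x).2, by simp [hz0], by simp [hz0], fun x hx => ?_,
    fun x hx => ?_⟩
  · have h : HasDerivWithinAt (fun x => (z x).1) (m x * clip R (z x).2) (Icc 0 1) x :=
      (hasFDerivAt_fst (𝕜 := ℝ) (p := z x)).comp_hasDerivWithinAt x (hz x hx)
    rwa [clip_of_abs_le ((norm_snd_le (z x)).trans (hbound x hx))] at h
  · have h : HasDerivWithinAt (fun x => (z x).2) (c x * clip R (z x).1) (Icc 0 1) x :=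
      (hasFDerivAt_snd (𝕜 := ℝ) (p := z x)).comp_hasDerivWithinAt x (hz x hx)
    rwa [clip_of_abs_le ((norm_fst_le (z x)).trans (hbound x hx))] at h

theorem linear_system_eq_zero {m c v w : ℝ → ℝ} (hm : ContinuousOn m (Icc 0 1))
    (hc : ContinuousOn c (Icc 0 1)) (hv0 : v 0 = 0) (hw0 : w 0 = 0)
    (hv : ∀ x ∈ Icc (0 : ℝ) 1, HasDerivWithinAt v (m x * w x) (Icc 0 1) x)
    (hw : ∀ x ∈ Icc (0 : ℝ) 1, HasDerivWithinAt w (c x * v x) (Icc 0 1) x) :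
    ∀ x ∈ Icc (0 : ℝ) 1, v x = 0 := by
  obtain ⟨K₁, hK₁, hmK⟩ := exists_bound_unit hm
  obtain ⟨K₂, hK₂, hcK⟩ := exists_bound_unit hc
  have hz : ∀ x ∈ Icc (0 : ℝ) 1, HasDerivWithinAt (fun x => (v x, w x)) (m x * w x, c x * v x)
      (Icc 0 1) x := fun x hx => (hv x hx).prodMk (hw x hx)
  have key := eq_zero_of_abs_deriv_le_mul_abs_self_of_eq_zero_right (f := fun x => (v x, w x))
    (f' := fun x => (m x * w x, c x * v x)) (K := max K₁ K₂) (a := 0) (b := 1)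
    (fun y hy => (hz y hy).continuousWithinAt)
    (fun y hy => (hz y (Ico_subset_Icc_self hy)).mono_of_mem_nhdsWithin
        (mem_of_superset (Icc_mem_nhdsGE hy.2) (Icc_subset_Icc_left hy.1)))
    (by simp [hv0, hw0]) (fun y hy => ?_)
  · exact fun x hx => congrArg Prod.fst (key x hx)
  · have hy' := Ico_subset_Icc_self hy
    simp only [Prod.norm_def, Real.norm_eq_abs, abs_mul]
    exact max_le (mul_le_mul ((hmK y hy').trans (le_max_left _ _)) (le_max_right _ _)
        (abs_nonneg _) (hK₁.trans (le_max_left _ _)))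
      (mul_le_mul ((hcK y hy').trans (le_max_right _ _)) (le_max_left _ _)
        (abs_nonneg _) (hK₁.trans (le_max_left _ _)))

/-! ### Flux, Lagrange's identity and Green's formula -/

namespace SLData

variable (S : SLData)

/-- The flux `p g'`. -/
def flux (g : ℝ → ℝ) (x : ℝ) : ℝ := S.p x * dx g x

theorem p_ne_zero {x : ℝ} (hx : x ∈ Icc (0 : ℝ) 1) : S.p x ≠ 0 := (S.p_pos x hx).ne'

theorem r_ne_zero {x : ℝ} (hx : x ∈ Icc (0 : ℝ) 1) : S.r x ≠ 0 := (S.r_pos x hx).ne'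

theorem b_sq_pos : 0 < S.b₁ ^ 2 + S.b₂ ^ 2 := by
  have h := S.b_pos
  by_contra hn
  have h1 : S.b₁ = 0 := by nlinarith [sq_nonneg S.b₁, sq_nonneg S.b₂]
  have h2 : S.b₂ = 0 := by nlinarith [sq_nonneg S.b₁, sq_nonneg S.b₂]
  simp [h1, h2] at h

theorem a_sq_pos : 0 < S.a₁ ^ 2 + S.a₂ ^ 2 := by
  have h := S.a_pos
  by_contra hn
  have h1 : S.a₁ = 0 := by nlinarith [sq_nonneg S.a₁, sq_nonneg S.a₂]
  have h2 : S.a₂ = 0 := by nlinarith [sq_nonneg S.a₁, sq_nonneg S.a₂]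
  simp [h1, h2] at h

variable {S} {g h : ℝ → ℝ}

theorem contDiffOn_flux (hg : ContDiffOn ℝ 2 g (Icc 0 1)) : ContDiffOn ℝ 1 (S.flux g) (Icc 0 1) :=
  S.p_contDiffOn.mul (hg.derivWithin uniqueDiffOn_unit (by norm_num))

theorem hasDerivWithinAt_flux (hg : ContDiffOn ℝ 2 g (Icc 0 1)) {x : ℝ} (hx : x ∈ Icc (0 : ℝ) 1) :
    HasDerivWithinAt (S.flux g) (dx (S.flux g) x) (Icc 0 1) x :=
  (contDiffOn_flux hg).hasDerivWithinAt_dx one_ne_zero hx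

theorem continuousOn_dx_flux (hg : ContDiffOn ℝ 2 g (Icc 0 1)) :
    ContinuousOn (dx (S.flux g)) (Icc 0 1) :=
  (contDiffOn_flux hg).continuousOn_derivWithin uniqueDiffOn_unit le_rfl

theorem A_eq (g : ℝ → ℝ) (x : ℝ) :
    S.A g x = -(1 / S.r x) * dx (S.flux g) x + S.q x / S.r x * g x := rfl

theorem r_mul_A (g : ℝ → ℝ) {x : ℝ} (hx : x ∈ Icc (0 : ℝ) 1) :
    S.r x * S.A g x = -dx (S.flux g) x + S.q x * g x := by
  rw [A_eq]
  field_simp [S.r_ne_zero hx]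

theorem continuousOn_A (hg : ContDiffOn ℝ 2 g (Icc 0 1)) : ContinuousOn (S.A g) (Icc 0 1) := by
  have hr : ∀ x ∈ Icc (0 : ℝ) 1, S.r x ≠ 0 := fun x hx => S.r_ne_zero hx
  exact ((continuousOn_const.div S.r_continuousOn hr).neg.mul (continuousOn_dx_flux hg)).add
    ((S.q_continuousOn.div S.r_continuousOn hr).mul hg.continuousOn)

theorem dx_eq_flux_div (g : ℝ → ℝ) {x : ℝ} (hx : x ∈ Icc (0 : ℝ) 1) :
    dx g x = S.flux g x / S.p x := by
  rw [flux, mul_div_cancel_left₀ _ (S.p_ne_zero hx)]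

/-- A pair `(g, h)` with `p g' = h` and `h' = k` continuous comes from a `C²` function. -/
theorem contDiffOn_two_of_flux {k : ℝ → ℝ}
    (hg : ∀ x ∈ Icc (0 : ℝ) 1, HasDerivWithinAt g (h x / S.p x) (Icc 0 1) x)
    (hh : ∀ x ∈ Icc (0 : ℝ) 1, HasDerivWithinAt h (k x) (Icc 0 1) x)
    (hk : ContinuousOn k (Icc 0 1)) :
    ContDiffOn ℝ 2 g (Icc 0 1) ∧ (∀ x ∈ Icc (0 : ℝ) 1, S.flux g x = h x) ∧
      ∀ x ∈ Icc (0 : ℝ) 1, dx (S.flux g) x = k x := by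
  have hdx : ∀ x ∈ Icc (0 : ℝ) 1, dx g x = h x / S.p x := fun x hx => (hg x hx).dx_eq hx
  have hfl : EqOn (S.flux g) h (Icc 0 1) := fun x hx => by
    rw [flux, hdx x hx, mul_div_cancel₀ _ (S.p_ne_zero hx)]
  have hh1 : ContDiffOn ℝ 1 h (Icc 0 1) := by
    rw [contDiffOn_one_iff_derivWithin uniqueDiffOn_unit]
    exact ⟨fun x hx => (hh x hx).differentiableWithinAt, hk.congr fun x hx => (hh x hx).dx_eq hx⟩
  refine ⟨?_, hfl, fun x hx => by rw [dx_congr hfl hx, (hh x hx).dx_eq hx]⟩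
  rw [show (2 : WithTop ℕ∞) = 1 + 1 by norm_num, contDiffOn_succ_iff_derivWithin uniqueDiffOn_unit]
  refine ⟨fun x hx => (hg x hx).differentiableWithinAt, by simp, ?_⟩
  exact (hh1.div S.p_contDiffOn fun x hx => S.p_ne_zero hx).congr hdx

theorem hasDerivWithinAt_of_flux (hg : ContDiffOn ℝ 2 g (Icc 0 1)) {x : ℝ}
    (hx : x ∈ Icc (0 : ℝ) 1) : HasDerivWithinAt g (S.flux g x / S.p x) (Icc 0 1) x := by
  rw [← dx_eq_flux_div g hx]
  exact hg.hasDerivWithinAt_dx two_ne_zero hx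

theorem hasDerivWithinAt_wronskian (hg : ContDiffOn ℝ 2 g (Icc 0 1))
    (hh : ContDiffOn ℝ 2 h (Icc 0 1)) {x : ℝ} (hx : x ∈ Icc (0 : ℝ) 1) :
    HasDerivWithinAt (fun x => g x * S.flux h x - h x * S.flux g x)
      (g x * dx (S.flux h) x - h x * dx (S.flux g) x) (Icc 0 1) x := by
  have := ((hasDerivWithinAt_of_flux (S := S) hg hx).mul (hasDerivWithinAt_flux (S := S) hh hx)).sub
    ((hasDerivWithinAt_of_flux (S := S) hh hx).mul (hasDerivWithinAt_flux (S := S) hg hx))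
  convert! this using 1
  ring

/-- Lagrange's identity, integrated. -/
theorem integral_wronskian (hg : ContDiffOn ℝ 2 g (Icc 0 1)) (hh : ContDiffOn ℝ 2 h (Icc 0 1)) :
    ∫ x in (0 : ℝ)..1, (g x * dx (S.flux h) x - h x * dx (S.flux g) x) =
      (g 1 * S.flux h 1 - h 1 * S.flux g 1) - (g 0 * S.flux h 0 - h 0 * S.flux g 0) :=
  integral_of_hasDerivWithinAt_unit (fun _ hx => hasDerivWithinAt_wronskian hg hh hx)
    ((hg.continuousOn.mul (continuousOn_dx_flux hh)).sub
      (hh.continuousOn.mul (continuousOn_dx_flux hg)))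

/-- The value of an element of the domain at `0` is proportional to `(-b₂, b₁)`. -/
def trace₀ (S : SLData) (φ : ℝ → ℝ) : ℝ :=
  (S.b₁ * dx φ 0 - S.b₂ * φ 0) / (S.b₁ ^ 2 + S.b₂ ^ 2)

/-- The value of an element of the domain at `1` is proportional to `(-a₂, a₁)`. -/
def trace₁ (S : SLData) (φ : ℝ → ℝ) : ℝ :=
  (S.a₁ * dx φ 1 - S.a₂ * φ 1) / (S.a₁ ^ 2 + S.a₂ ^ 2)

/-- The boundary condition makes (φ 0, φ' 0) orthogonal to (b₁, b₂), hence a multiple of (-b₂, b₁),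
and `trace₀` is the factor. -/
theorem eq_trace₀ {φ : ℝ → ℝ} (hφ : S.bc0 φ = 0) :
    φ 0 = -S.b₂ * S.trace₀ φ ∧ dx φ 0 = S.b₁ * S.trace₀ φ := by
  have h := S.b_sq_pos.ne'
  unfold bc0 at hφ
  unfold trace₀
  constructor
  · field_simp
    linear_combination S.b₁ * hφ
  · field_simp
    linear_combination S.b₂ * hφ

theorem eq_trace₁ {φ : ℝ → ℝ} (hφ : S.bc1 φ = 0) :
    φ 1 = -S.a₂ * S.trace₁ φ ∧ dx φ 1 = S.a₁ * S.trace₁ φ := by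
  have h := S.a_sq_pos.ne'
  unfold bc1 at hφ
  unfold trace₁
  constructor
  · field_simp
    linear_combination S.a₁ * hφ
  · field_simp
    linear_combination S.a₂ * hφ

/-- Green's formula against a function satisfying the homogeneous boundary conditions. -/
theorem integral_mul_A {φ : ℝ → ℝ} (hφ : ContDiffOn ℝ 2 φ (Icc 0 1)) (h0 : S.bc0 φ = 0)
    (h1 : S.bc1 φ = 0) (hg : ContDiffOn ℝ 2 g (Icc 0 1)) :
    ∫ x in (0 : ℝ)..1, S.r x * φ x * S.A g x =
      (∫ x in (0 : ℝ)..1, S.r x * S.A φ x * g x) + S.p 1 * S.trace₁ φ * S.bc1 g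
        - S.p 0 * S.trace₀ φ * S.bc0 g := by
  have hc : ∀ {u v : ℝ → ℝ}, ContinuousOn u (Icc 0 1) → ContinuousOn v (Icc 0 1) →
      IntervalIntegrable (fun x => S.r x * u x * v x) volume 0 1 := fun hu hv =>
    ContinuousOn.intervalIntegrable (by
      rw [uIcc_of_le zero_le_one]; exact (S.r_continuousOn.mul hu).mul hv)
  have key : (∫ x in (0 : ℝ)..1, S.r x * φ x * S.A g x) - ∫ x in (0 : ℝ)..1, S.r x * S.A φ x * g x
      = ∫ x in (0 : ℝ)..1, (g x * dx (S.flux φ) x - φ x * dx (S.flux g) x) := by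
    rw [← intervalIntegral.integral_sub (hc hφ.continuousOn (continuousOn_A hg))
      (hc (continuousOn_A hφ) hg.continuousOn)]
    refine intervalIntegral.integral_congr fun x hx => ?_
    rw [uIcc_of_le zero_le_one] at hx
    have e1 := r_mul_A (S := S) g hx
    have e2 := r_mul_A (S := S) φ hx
    linear_combination φ x * e1 - g x * e2
  rw [integral_wronskian hg hφ] at key
  obtain ⟨z1, z2⟩ := eq_trace₀ h0
  obtain ⟨z3, z4⟩ := eq_trace₁ h1
  have e : (∫ x in (0 : ℝ)..1, S.r x * φ x * S.A g x) =
    (∫ x in (0 : ℝ)..1, S.r x * S.A φ x * g x) + ((g 1 * S.flux φ 1 - φ 1 * S.flux g 1) -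
      (g 0 * S.flux φ 0 - φ 0 * S.flux g 0)) := by linarith
  rw [e]
  unfold flux bc0 bc1
  -- With φ = -b₂ t and φ' = b₁ t at 0, where t = `trace₀` φ, the boundary form p (g φ' - φ g')
  -- collapses to p t (b₁ g + b₂ g'); similarly at 1. Only the boundary data of g survive.
  rw [z2, z4]
  linear_combination (S.p 0 * dx g 0) * z1 - (S.p 1 * dx g 1) * z3

end SLData

/-! ### The homogeneous equation and Green's function -/

namespace SLData

variable {S : SLData} {g h : ℝ → ℝ}

theorem dx_lin (hg : ContDiffOn ℝ 1 g (Icc 0 1)) (hh : ContDiffOn ℝ 1 h (Icc 0 1)) (a b : ℝ)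
    {x : ℝ} (hx : x ∈ Icc (0 : ℝ) 1) :
    dx (fun x => a * g x + b * h x) x = a * dx g x + b * dx h x :=
  (((hg.hasDerivWithinAt_dx one_ne_zero hx).const_mul a).add
    ((hh.hasDerivWithinAt_dx one_ne_zero hx).const_mul b)).dx_eq hx

theorem contDiffOn_lin {n : WithTop ℕ∞} (hg : ContDiffOn ℝ n g (Icc 0 1))
    (hh : ContDiffOn ℝ n h (Icc 0 1)) (a b : ℝ) :
    ContDiffOn ℝ n (fun x => a * g x + b * h x) (Icc 0 1) :=
  (contDiffOn_const.mul hg).add (contDiffOn_const.mul hh)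

theorem dx_flux_lin (hg : ContDiffOn ℝ 2 g (Icc 0 1)) (hh : ContDiffOn ℝ 2 h (Icc 0 1)) (a b : ℝ)
    {x : ℝ} (hx : x ∈ Icc (0 : ℝ) 1) :
    dx (S.flux fun x => a * g x + b * h x) x = a * dx (S.flux g) x + b * dx (S.flux h) x := by
  rw [← dx_lin (contDiffOn_flux hg) (contDiffOn_flux hh) a b hx]
  refine dx_congr (fun y hy => ?_) hx
  simp only [flux]
  rw [dx_lin (hg.of_le one_le_two) (hh.of_le one_le_two) a b hy]
  ring

theorem A_lin (hg : ContDiffOn ℝ 2 g (Icc 0 1)) (hh : ContDiffOn ℝ 2 h (Icc 0 1)) (a b : ℝ)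
    {x : ℝ} (hx : x ∈ Icc (0 : ℝ) 1) :
    S.A (fun x => a * g x + b * h x) x = a * S.A g x + b * S.A h x := by
  simp only [A_eq]
  rw [dx_flux_lin hg hh a b hx]
  ring

theorem bc0_lin (hg : ContDiffOn ℝ 2 g (Icc 0 1)) (hh : ContDiffOn ℝ 2 h (Icc 0 1)) (a b : ℝ) :
    S.bc0 (fun x => a * g x + b * h x) = a * S.bc0 g + b * S.bc0 h := by
  simp only [bc0]
  rw [dx_lin (hg.of_le one_le_two) (hh.of_le one_le_two) a b (left_mem_Icc.2 zero_le_one)]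
  ring

theorem bc1_lin (hg : ContDiffOn ℝ 2 g (Icc 0 1)) (hh : ContDiffOn ℝ 2 h (Icc 0 1)) (a b : ℝ) :
    S.bc1 (fun x => a * g x + b * h x) = a * S.bc1 g + b * S.bc1 h := by
  simp only [bc1]
  rw [dx_lin (hg.of_le one_le_two) (hh.of_le one_le_two) a b (right_mem_Icc.2 zero_le_one)]
  ring

theorem inH2_of_contDiffOn (hg : ContDiffOn ℝ 2 g (Icc 0 1)) : InH2 g := by
  have h1 : ContDiffOn ℝ 1 (dx g) (Icc 0 1) := hg.derivWithin uniqueDiffOn_unit (by norm_num)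
  have hc : ContinuousOn (dx (dx g)) (Icc 0 1) :=
    h1.continuousOn_derivWithin uniqueDiffOn_unit le_rfl
  refine ⟨hg.of_le one_le_two, dx (dx g), ?_, fun x hx => ?_⟩
  · obtain ⟨K, -, hK⟩ := exists_bound_unit hc
    exact MemLp.of_bound (hc.aestronglyMeasurable measurableSet_Icc) K
      ((ae_restrict_iff' measurableSet_Icc).2 (Eventually.of_forall hK))
  · have hsub : Icc 0 x ⊆ Icc (0 : ℝ) 1 := Icc_subset_Icc_right hx.2
    rw [intervalIntegral.integral_eq_sub_of_hasDerivAt_of_le hx.1 (h1.continuousOn.mono hsub)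
      (fun y hy => (h1.hasDerivWithinAt_dx one_ne_zero (hsub (Ioo_subset_Icc_self hy))).hasDerivAt
        (Icc_mem_nhds hy.1 (hy.2.trans_le hx.2)))
      (ContinuousOn.intervalIntegrable (by rw [uIcc_of_le hx.1]; exact hc.mono hsub))]
    ring

/-- A classical solution of `A g = μ g` with homogeneous boundary conditions vanishes if `μ` is
not an eigenvalue. -/
theorem eq_zero_of_not_isEigenvalue {μ : ℝ} (hμ : ¬ S.IsEigenvalue μ)
    (hg : ContDiffOn ℝ 2 g (Icc 0 1)) (h0 : S.bc0 g = 0) (h1 : S.bc1 g = 0)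
    (hA : ∀ x ∈ Icc (0 : ℝ) 1, S.A g x = μ * g x) {x : ℝ} (hx : x ∈ Icc (0 : ℝ) 1) : g x = 0 := by
  by_contra hne
  exact hμ ⟨g, ⟨inH2_of_contDiffOn hg, h0, h1⟩, ⟨x, hx, hne⟩,
    (ae_restrict_iff' measurableSet_Ioo).2
      (Eventually.of_forall fun y hy => hA y (Ioo_subset_Icc_self hy))⟩

theorem continuousOn_inv_p : ContinuousOn (fun x => (S.p x)⁻¹) (Icc 0 1) :=
  S.p_contDiffOn.continuousOn.inv₀ fun _ hx => S.p_ne_zero hx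

/-- Uniqueness for the initial value problem. -/
theorem eq_zero_of_initial {μ : ℝ} (hg : ContDiffOn ℝ 2 g (Icc 0 1))
    (hA : ∀ x ∈ Icc (0 : ℝ) 1, S.A g x = μ * g x) (h0 : g 0 = 0) (h0' : dx g 0 = 0) :
    ∀ x ∈ Icc (0 : ℝ) 1, g x = 0 := by
  -- The pair (g, p g') solves g' = p⁻¹ (p g') and (p g')' = (q - μ r) g, a system with continuous
  -- coefficients.
  refine linear_system_eq_zero (m := fun x => (S.p x)⁻¹) (c := fun x => S.q x - μ * S.r x)
    (w := S.flux g) continuousOn_inv_p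
    (S.q_continuousOn.sub (continuousOn_const.mul S.r_continuousOn)) h0 (by simp [flux, h0'])
    (fun x hx => ?_) (fun x hx => ?_)
  · have := hasDerivWithinAt_of_flux (S := S) hg hx
    rwa [div_eq_inv_mul] at this
  · have h := hasDerivWithinAt_flux (S := S) hg hx
    have e := r_mul_A (S := S) g hx
    rw [hA x hx] at e
    convert! h using 1
    linear_combination -e

/-- Two solutions of `A g = μ g` satisfying the boundary condition at `0` are proportional. -/
theorem eq_smul_of_bc0 {μ : ℝ} {φ : ℝ → ℝ} (hg : ContDiffOn ℝ 2 g (Icc 0 1))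
    (hφ : ContDiffOn ℝ 2 φ (Icc 0 1)) (hgA : ∀ x ∈ Icc (0 : ℝ) 1, S.A g x = μ * g x)
    (hφA : ∀ x ∈ Icc (0 : ℝ) 1, S.A φ x = μ * φ x) (hg0 : S.bc0 g = 0) (hφ0 : S.bc0 φ = 0)
    (hne : ∃ x ∈ Icc (0 : ℝ) 1, φ x ≠ 0) : ∃ c : ℝ, ∀ x ∈ Icc (0 : ℝ) 1, g x = c * φ x := by
  obtain ⟨g1, g2⟩ := eq_trace₀ hg0
  obtain ⟨f1, f2⟩ := eq_trace₀ hφ0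
  have ht : S.trace₀ φ ≠ 0 := by
    intro ht
    obtain ⟨x, hx, hn⟩ := hne
    exact hn (eq_zero_of_initial hφ hφA (by rw [f1, ht, mul_zero]) (by rw [f2, ht, mul_zero]) x hx)
  -- This ratio makes g - c φ have vanishing value and derivative at 0.
  set c := S.trace₀ g / S.trace₀ φ with hc
  have hcφ : c * S.trace₀ φ = S.trace₀ g := div_mul_cancel₀ _ ht
  refine ⟨c, fun x hx => ?_⟩
  have key := eq_zero_of_initial (S := S) (μ := μ) (contDiffOn_lin hg hφ 1 (-c))
    (fun y hy => by rw [A_lin hg hφ 1 (-c) hy, hgA y hy, hφA y hy]; ring)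
    (by rw [g1, f1]; linear_combination S.b₂ * hcφ)
    (by
      rw [dx_lin (hg.of_le one_le_two) (hφ.of_le one_le_two) _ _ (left_mem_Icc.2 zero_le_one),
        g2, f2]
      linear_combination -S.b₁ * hcφ) x hx
  linarith

theorem exists_solution (S : SLData) (α β : ℝ) : ∃ v : ℝ → ℝ, ContDiffOn ℝ 2 v (Icc 0 1) ∧
    v 0 = α ∧ dx v 0 = β ∧ ∀ x ∈ Icc (0 : ℝ) 1, dx (S.flux v) x = S.q x * v x := by
  obtain ⟨v, w, hv0, hw0, hv, hw⟩ := exists_linear_system (m := fun x => (S.p x)⁻¹)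
    continuousOn_inv_p S.q_continuousOn α (S.p 0 * β)
  have hvc : ContinuousOn v (Icc 0 1) := fun x hx => (hv x hx).continuousWithinAt
  obtain ⟨h1, h2, h3⟩ := contDiffOn_two_of_flux (S := S) (g := v) (h := w)
    (fun x hx => by rw [div_eq_inv_mul]; exact hv x hx) hw (S.q_continuousOn.mul hvc)
  have h00 : (0 : ℝ) ∈ Icc (0 : ℝ) 1 := left_mem_Icc.2 zero_le_one
  refine ⟨v, h1, hv0, ?_, h3⟩
  rw [dx_eq_flux_div (S := S) v h00, h2 0 h00, hw0, mul_div_cancel_left₀ _ (S.p_ne_zero h00)]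

/-- `v₁`, `v₂` solve the homogeneous equation, `v₁` with the boundary condition at `0` and `v₂` with
the boundary condition at `1`, and their Wronskian is `W ≠ 0`. -/
structure IsFundamental (S : SLData) (v₁ v₂ : ℝ → ℝ) (W : ℝ) : Prop where
  contDiffOn₁ : ContDiffOn ℝ 2 v₁ (Icc 0 1)
  contDiffOn₂ : ContDiffOn ℝ 2 v₂ (Icc 0 1)
  ode₁ : ∀ x ∈ Icc (0 : ℝ) 1, dx (S.flux v₁) x = S.q x * v₁ x
  ode₂ : ∀ x ∈ Icc (0 : ℝ) 1, dx (S.flux v₂) x = S.q x * v₂ x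
  bc0₁ : S.bc0 v₁ = 0
  bc1₁ : S.bc1 v₁ ≠ 0
  bc0₂ : S.bc0 v₂ ≠ 0
  bc1₂ : S.bc1 v₂ = 0
  wronskian : ∀ x ∈ Icc (0 : ℝ) 1, v₁ x * S.flux v₂ x - v₂ x * S.flux v₁ x = W
  W_ne_zero : W ≠ 0

theorem A_eq_zero_iff (g : ℝ → ℝ) {x : ℝ} (hx : x ∈ Icc (0 : ℝ) 1) :
    S.A g x = 0 ↔ dx (S.flux g) x = S.q x * g x := by
  rw [← mul_right_inj' (S.r_ne_zero hx), r_mul_A g hx, mul_zero]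
  constructor <;> intro h <;> linarith

/-- A solution with the boundary condition at 0 cannot also satisfy the one at 1, since 0 is not an
eigenvalue. Hence a multiple of it can be subtracted from a second solution to enforce the condition
at 1. The Wronskian is constant and is computed at 0. -/
theorem exists_isFundamental (h0 : ¬ S.IsEigenvalue 0) : ∃ v₁ v₂ W, S.IsFundamental v₁ v₂ W := by
  have h00 : (0 : ℝ) ∈ Icc (0 : ℝ) 1 := left_mem_Icc.2 zero_le_one
  have hb := S.b_sq_pos
  -- The initial data of v are orthogonal to (b₁, b₂), those of y parallel to it.
  obtain ⟨v, hv, hv0, hv0', hode⟩ := S.exists_solution (-S.b₂) S.b₁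
  obtain ⟨y, hy, hy0, hy0', hyode⟩ := S.exists_solution S.b₁ S.b₂
  have hvbc : S.bc0 v = 0 := by rw [bc0, hv0, hv0']; ring
  have hybc : S.bc0 y = S.b₁ ^ 2 + S.b₂ ^ 2 := by rw [bc0, hy0, hy0']; ring
  have hvbc1 : S.bc1 v ≠ 0 := by
    intro hn
    have hz := fun x hx => eq_zero_of_not_isEigenvalue (x := x) h0 hv hvbc hn
      (fun x hx => by rw [zero_mul]; exact (A_eq_zero_iff v hx).2 (hode x hx)) hx
    have h1 : S.b₂ = 0 := by have := hz 0 h00; linarith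
    have h2 : S.b₁ = 0 := by
      rw [← hv0', dx_congr (h := fun _ => 0) (fun x hx => hz x hx) h00]
      exact (hasDerivWithinAt_const _ _ _).dx_eq h00
    rw [h1, h2] at hb
    norm_num at hb
  set c := S.bc1 y / S.bc1 v with hc
  set w : ℝ → ℝ := fun x => 1 * y x + (-c) * v x with hw
  have hwc : ContDiffOn ℝ 2 w (Icc 0 1) := contDiffOn_lin hy hv _ _
  have hwode : ∀ x ∈ Icc (0 : ℝ) 1, dx (S.flux w) x = S.q x * w x := fun x hx => by
    rw [hw, dx_flux_lin hy hv _ _ hx, hode x hx, hyode x hx]; ring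
  have hw0 : S.bc0 w = S.b₁ ^ 2 + S.b₂ ^ 2 := by rw [hw, bc0_lin hy hv, hvbc, hybc]; ring
  have hw1 : S.bc1 w = 0 := by rw [hw, bc1_lin hy hv, hc]; field_simp; ring
  have hcst : ∀ x ∈ Icc (0 : ℝ) 1, v x * S.flux w x - w x * S.flux v x =
      v 0 * S.flux w 0 - w 0 * S.flux v 0 := by
    refine constant_of_derivWithin_zero
      (fun x hx => (hasDerivWithinAt_wronskian hv hwc hx).differentiableWithinAt) fun x hx => ?_
    have hx' := Ico_subset_Icc_self hx
    rw [(hasDerivWithinAt_wronskian hv hwc hx').derivWithin (uniqueDiffOn_unit x hx'),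
      hode x hx', hwode x hx']
    ring
  refine ⟨v, w, _, hv, hwc, hode, hwode, hvbc, hvbc1, hw0 ▸ hb.ne', hw1, hcst, ?_⟩
  have e : v 0 * S.flux w 0 - w 0 * S.flux v 0 = -(S.p 0 * S.bc0 w) := by
    simp only [flux, bc0, hv0, hv0']; ring
  rw [e, hw0]
  exact neg_ne_zero.2 (mul_ne_zero (S.p_ne_zero h00) hb.ne')

/-- The solution of `A y = g` with homogeneous boundary conditions, by variation of constants. -/
def greenSolution (S : SLData) (v₁ v₂ : ℝ → ℝ) (W : ℝ) (g : ℝ → ℝ) (x : ℝ) : ℝ :=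
  -(1 / W) * (v₂ x * (∫ y in (0 : ℝ)..x, v₁ y * S.r y * g y) +
    v₁ x * ∫ y in x..1, v₂ y * S.r y * g y)

namespace IsFundamental

variable {v₁ v₂ : ℝ → ℝ} {W : ℝ}

/-- On differentiating, the contributions of the variable limits cancel in the first derivative; in
the derivative of the flux they combine to a multiple of the Wronskian and yield the inhomogeneity.
At 0 only v₁ remains, at 1 only v₂, which gives the boundary conditions. -/
theorem greenSolution_spec (hF : S.IsFundamental v₁ v₂ W) (hg : ContinuousOn g (Icc 0 1)) :
    ContDiffOn ℝ 2 (S.greenSolution v₁ v₂ W g) (Icc 0 1) ∧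
      (∀ x ∈ Icc (0 : ℝ) 1, S.A (S.greenSolution v₁ v₂ W g) x = g x) ∧
      S.bc0 (S.greenSolution v₁ v₂ W g) = 0 ∧ S.bc1 (S.greenSolution v₁ v₂ W g) = 0 := by
  have h00 : (0 : ℝ) ∈ Icc (0 : ℝ) 1 := left_mem_Icc.2 zero_le_one
  have h11 : (1 : ℝ) ∈ Icc (0 : ℝ) 1 := right_mem_Icc.2 zero_le_one
  have hW := hF.W_ne_zero
  have hc : ∀ {v : ℝ → ℝ}, ContDiffOn ℝ 2 v (Icc 0 1) →
      ContinuousOn (fun y => v y * S.r y * g y) (Icc 0 1) :=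
    fun hv => (hv.continuousOn.mul S.r_continuousOn).mul hg
  set F : ℝ → ℝ := fun x => ∫ y in (0 : ℝ)..x, v₁ y * S.r y * g y with hFd
  set G : ℝ → ℝ := fun x => ∫ y in x..1, v₂ y * S.r y * g y with hGd
  have dF : ∀ x ∈ Icc (0 : ℝ) 1, HasDerivWithinAt F (v₁ x * S.r x * g x) (Icc 0 1) x :=
    fun x hx => hasDerivWithinAt_integral_unit (hc hF.contDiffOn₁) hx
  have dG : ∀ x ∈ Icc (0 : ℝ) 1, HasDerivWithinAt G (-(v₂ x * S.r x * g x)) (Icc 0 1) x := by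
    intro x hx
    have h := (hasDerivWithinAt_integral_unit (hc hF.contDiffOn₂) hx).const_sub
      (∫ y in (0 : ℝ)..1, v₂ y * S.r y * g y)
    refine h.congr_of_mem (fun y hy => ?_) hx
    have hi : ∀ {a b : ℝ}, a ∈ Icc (0 : ℝ) 1 → b ∈ Icc (0 : ℝ) 1 →
        IntervalIntegrable (fun y => v₂ y * S.r y * g y) volume a b := fun ha hb =>
      ((hc hF.contDiffOn₂).mono (ordConnected_Icc.uIcc_subset ha hb)).intervalIntegrable
    rw [hGd, intervalIntegral.integral_interval_sub_left (hi h00 h11) (hi h00 hy)]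
  set u := S.greenSolution v₁ v₂ W g with hu
  have hue : ∀ x, u x = -(1 / W) * (v₂ x * F x + v₁ x * G x) := fun x => rfl
  have d1 : ∀ x ∈ Icc (0 : ℝ) 1, HasDerivWithinAt u
      (-(1 / W) * (S.flux v₂ x * F x + S.flux v₁ x * G x) / S.p x) (Icc 0 1) x := by
    intro x hx
    have h := (((hasDerivWithinAt_of_flux (S := S) hF.contDiffOn₂ hx).mul (dF x hx)).add
      ((hasDerivWithinAt_of_flux (S := S) hF.contDiffOn₁ hx).mul (dG x hx))).const_mul (-(1 / W))
    convert! h using 1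
    ring
  have hFc : ContinuousOn F (Icc 0 1) := fun x hx => (dF x hx).continuousWithinAt
  have hGc : ContinuousOn G (Icc 0 1) := fun x hx => (dG x hx).continuousWithinAt
  have huc : ContinuousOn u (Icc 0 1) := fun x hx => (d1 x hx).continuousWithinAt
  have d2 : ∀ x ∈ Icc (0 : ℝ) 1, HasDerivWithinAt
      (fun x => -(1 / W) * (S.flux v₂ x * F x + S.flux v₁ x * G x))
      (S.q x * u x - S.r x * g x) (Icc 0 1) x := by
    intro x hx
    have h := (((hasDerivWithinAt_flux (S := S) hF.contDiffOn₂ hx).mul (dF x hx)).add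
      ((hasDerivWithinAt_flux (S := S) hF.contDiffOn₁ hx).mul (dG x hx))).const_mul (-(1 / W))
    convert! h using 1
    rw [hF.ode₁ x hx, hF.ode₂ x hx, hue]
    have hw := hF.wronskian x hx
    field_simp
    linear_combination (S.r x * g x) * hw
  obtain ⟨c1, c2, c3⟩ := contDiffOn_two_of_flux d1 d2
    ((S.q_continuousOn.mul huc).sub (S.r_continuousOn.mul hg))
  have hF0 : F 0 = 0 := intervalIntegral.integral_same
  have hG1 : G 1 = 0 := intervalIntegral.integral_same
  have hdx : ∀ x ∈ Icc (0 : ℝ) 1, dx u x = -(1 / W) * (dx v₂ x * F x + dx v₁ x * G x) := by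
    intro x hx
    have hp := S.p_ne_zero hx
    rw [dx_eq_flux_div (S := S) u hx, c2 x hx, flux, flux]
    field_simp
  refine ⟨c1, fun x hx => ?_, ?_, ?_⟩
  · rw [← mul_right_inj' (S.r_ne_zero hx), r_mul_A u hx, c3 x hx]
    ring
  · have := hF.bc0₁
    unfold bc0 at this ⊢
    rw [hdx 0 h00, hue, hF0]
    linear_combination (-(1 / W) * G 0) * this
  · have := hF.bc1₂
    unfold bc1 at this ⊢
    rw [hdx 1 h11, hue, hG1]
    linear_combination (-(1 / W) * F 1) * this

/-- The difference of the two sides is annihilated by A and satisfies both boundary conditions, so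
it vanishes because 0 is not an eigenvalue. -/
theorem greenSolution_A (hF : S.IsFundamental v₁ v₂ W) (h0 : ¬ S.IsEigenvalue 0)
    (hg : ContDiffOn ℝ 2 g (Icc 0 1)) (hg0 : S.bc0 g = 0) (hg1 : S.bc1 g = 0) :
    ∀ x ∈ Icc (0 : ℝ) 1, S.greenSolution v₁ v₂ W (S.A g) x = g x := by
  intro x hx
  obtain ⟨h1, h2, h3, h4⟩ := hF.greenSolution_spec (continuousOn_A (S := S) hg)
  have := eq_zero_of_not_isEigenvalue h0 (contDiffOn_lin h1 hg 1 (-1))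
    (by rw [bc0_lin h1 hg, h3, hg0]; ring) (by rw [bc1_lin h1 hg, h4, hg1]; ring)
    (fun y hy => by rw [A_lin h1 hg _ _ hy, h2 y hy]; ring) hx
  linarith

end IsFundamental

end SLData

/-! ### Integral operators on `L²(0,1)` -/

section InnerOperator

variable {X H : Type*} [TopologicalSpace X] [CompactSpace X] [NormedAddCommGroup H]
  [InnerProductSpace ℝ H]

/-- The operator `g ↦ (x ↦ ⟪K x, g⟫)` from a Hilbert space to continuous functions. -/
def innerOperator (K : C(X, H)) : H →L[ℝ] BoundedContinuousFunction X ℝ :=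
  LinearMap.mkContinuous
    { toFun := fun g => BoundedContinuousFunction.mkOfCompact
        ⟨fun x => inner ℝ (K x) g, K.continuous.inner continuous_const⟩
      map_add' := fun g h => by ext x; simp [inner_add_right]
      map_smul' := fun c g => by ext x; simp [inner_smul_right] } ‖K‖ fun g => by
        refine (BoundedContinuousFunction.norm_le (by positivity)).2 fun x => ?_
        exact (norm_inner_le_norm _ _).trans
          (mul_le_mul_of_nonneg_right (K.norm_coe_le_norm x) (norm_nonneg _))

theorem innerOperator_apply (K : C(X, H)) (g : H) (x : X) :
    innerOperator K g x = inner ℝ (K x) g := rfl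

/-- Arzelà-Ascoli: the image of the unit ball is bounded by ‖K‖, and by Cauchy-Schwarz ‖K x₀ - K x‖
is a modulus of continuity at x₀ common to all its members. -/
theorem isCompactOperator_innerOperator (K : C(X, H)) : IsCompactOperator (innerOperator K) := by
  rw [isCompactOperator_iff_exists_mem_nhds_isCompact_closure_image]
  refine ⟨Metric.ball 0 1, Metric.ball_mem_nhds _ one_pos, ?_⟩
  refine BoundedContinuousFunction.arzela_ascoli (Metric.closedBall 0 ‖K‖)
    (isCompact_closedBall 0 ‖K‖) _ ?_ ?_
  · rintro _ x ⟨g, hg, rfl⟩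
    rw [mem_ball_zero_iff] at hg
    rw [mem_closedBall_zero_iff, innerOperator_apply]
    calc ‖inner ℝ (K x) g‖ ≤ ‖K x‖ * ‖g‖ := norm_inner_le_norm _ _
      _ ≤ ‖K‖ * 1 := mul_le_mul (K.norm_coe_le_norm x) hg.le (norm_nonneg _) (norm_nonneg _)
      _ = ‖K‖ := mul_one _
  · intro x₀
    refine Metric.equicontinuousAt_of_continuity_modulus (fun x => ‖K x₀ - K x‖) ?_ _ ?_
    · have h : Tendsto (fun x => ‖K x₀ - K x‖) (𝓝 x₀) (𝓝 ‖K x₀ - K x₀‖) :=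
        (continuous_const.sub K.continuous).norm.tendsto x₀
      simpa using h
    · filter_upwards with x
      rintro ⟨_, g, hg, rfl⟩
      rw [mem_ball_zero_iff] at hg
      rw [Real.dist_eq, innerOperator_apply, innerOperator_apply, ← inner_sub_left]
      exact (norm_inner_le_norm (𝕜 := ℝ) _ _).trans (mul_le_of_le_one_right (norm_nonneg _) hg.le)

end InnerOperator

/-- The Hilbert space `L²(0,1)`. -/
abbrev UnitL2 : Type := Lp ℝ 2 (volume : Measure unitInterval)

/-- The integral operator with kernel `k`, with values in continuous functions. -/
def kernelMap (k : C(unitInterval × unitInterval, ℝ)) :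
    UnitL2 →L[ℝ] BoundedContinuousFunction unitInterval ℝ :=
  innerOperator ⟨fun x => ContinuousMap.toLp (E := ℝ) 2 volume ℝ (k.curry x),
    (ContinuousLinearMap.continuous _).comp k.curry.continuous⟩

/-- The integral operator with kernel `k` on `L²(0,1)`. -/
def kernelOperator (k : C(unitInterval × unitInterval, ℝ)) : UnitL2 →L[ℝ] UnitL2 :=
  (BoundedContinuousFunction.toLp (E := ℝ) 2 volume ℝ).comp (kernelMap k)

theorem isCompactOperator_kernelOperator (k : C(unitInterval × unitInterval, ℝ)) :
    IsCompactOperator (kernelOperator k) :=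
  IsCompactOperator.clm_comp (f := kernelMap k) (isCompactOperator_innerOperator _)
    (BoundedContinuousFunction.toLp 2 volume ℝ)

theorem kernelMap_apply (k : C(unitInterval × unitInterval, ℝ)) (g : UnitL2) (x : unitInterval) :
    kernelMap k g x = ∫ y, k (x, y) * g y := by
  rw [kernelMap, innerOperator_apply, L2.inner_def]
  refine integral_congr_ae ?_
  filter_upwards [ContinuousMap.coeFn_toLp (p := 2) (𝕜 := ℝ) (volume : Measure unitInterval)
    (k.curry x)] with y hy
  simp only [RCLike.inner_apply, conj_trivial]
  rw [mul_comm]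
  congr 1

theorem kernelOperator_ae (k : C(unitInterval × unitInterval, ℝ)) (g : UnitL2) :
    kernelOperator k g =ᵐ[volume] fun x => ∫ y, k (x, y) * g y := by
  filter_upwards [BoundedContinuousFunction.coeFn_toLp (p := 2) (𝕜 := ℝ)
    (volume : Measure unitInterval) (kernelMap k g)] with x hx
  rw [← kernelMap_apply]
  exact hx

theorem UnitL2.integrable (g : UnitL2) : Integrable g (volume : Measure unitInterval) :=
  (Lp.memLp g).integrable (by norm_num)

theorem kernelOperator_isSymmetric {k : C(unitInterval × unitInterval, ℝ)}
    (hk : ∀ x y, k (x, y) = k (y, x)) : (kernelOperator k).IsSymmetric := by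
  intro f g
  have e1 : inner ℝ (kernelOperator k f) g =
      ∫ x, ∫ y, k (x, y) * (f y * g x) := by
    rw [L2.inner_def]
    refine integral_congr_ae ?_
    filter_upwards [kernelOperator_ae k f] with x hx
    simp only [RCLike.inner_apply, conj_trivial, hx]
    rw [mul_comm, ← integral_mul_const]
    exact integral_congr_ae (Eventually.of_forall fun y => by ring)
  have e2 : inner ℝ f (kernelOperator k g) =
      ∫ y, ∫ x, k (x, y) * (f y * g x) := by
    rw [L2.inner_def]
    refine integral_congr_ae ?_
    filter_upwards [kernelOperator_ae k g] with y hy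
    simp only [RCLike.inner_apply, conj_trivial, hy]
    rw [← integral_mul_const]
    exact integral_congr_ae (Eventually.of_forall fun x => by simp only [hk y x]; ring)
  refine e1.trans (Eq.trans ?_ e2.symm)
  -- Fubini applies since L² functions on the unit interval are integrable and the kernel is
  -- bounded.
  refine integral_integral_swap ?_
  have hfg : Integrable (fun z : unitInterval × unitInterval => f z.2 * g z.1)
      (volume.prod volume) := by
    have := (UnitL2.integrable g).mul_prod (UnitL2.integrable f)
    exact this.congr (Eventually.of_forall fun z => mul_comm _ _)
  exact hfg.bdd_mul k.continuous.aestronglyMeasurable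
    (Eventually.of_forall fun z => k.norm_coe_le_norm z)

/-! ### Transfer between `L²_r(0,1)` and `L²(0,1)` -/

theorem integral_unitInterval (F : ℝ → ℝ) : ∫ x : unitInterval, F x = ∫ x in (0 : ℝ)..1, F x := by
  rw [intervalIntegral.integral_of_le zero_le_one, ← integral_Icc_eq_integral_Ioc]
  exact integral_subtype_comap measurableSet_Icc F

theorem integrable_unitInterval_iff {F : ℝ → ℝ} :
    Integrable (fun x : unitInterval => F x) ↔ IntervalIntegrable F volume 0 1 := by
  rw [intervalIntegrable_iff_integrableOn_Icc_of_le zero_le_one]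
  exact unitInterval.measurePreserving_coe.integrable_comp_emb
    (MeasurableEmbedding.subtype_coe measurableSet_Icc)

namespace SLData

variable {S : SLData} {g h : ℝ → ℝ}

theorem continuous_sqrt_r : Continuous fun x : unitInterval => Real.sqrt (S.r x) :=
  Real.continuous_sqrt.comp (continuousOn_iff_continuous_domRestrict.1 S.r_continuousOn)

theorem MemL2.memLp (hg : S.MemL2 g) :
    MemLp (fun x : unitInterval => Real.sqrt (S.r x) * g x) 2 volume := by
  have hm : AEStronglyMeasurable (fun x : unitInterval => Real.sqrt (S.r x) * g x) volume := by
    refine continuous_sqrt_r.aestronglyMeasurable.mul ?_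
    have : AEStronglyMeasurable g (volume.restrict (Icc 0 1)) := by
      rw [← restrict_Ioc_eq_restrict_Icc]; exact hg.1
    exact this.comp_measurePreserving unitInterval.measurePreserving_coe
  rw [memLp_two_iff_integrable_sq hm]
  refine (integrable_unitInterval_iff.2 hg.2).congr (Eventually.of_forall fun x => ?_)
  simp only [mul_pow, Real.sq_sqrt (S.r_pos x x.2).le]

/-- The isometry `g ↦ √r g` from `L²_r(0,1)` to `L²(0,1)`. -/
def toUnitL2 (hg : S.MemL2 g) : UnitL2 := hg.memLp.toLp _

theorem coeFn_toUnitL2 (hg : S.MemL2 g) :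
    toUnitL2 hg =ᵐ[volume] fun x : unitInterval => Real.sqrt (S.r x) * g x :=
  MemLp.coeFn_toLp _

theorem inner_toUnitL2 (hg : S.MemL2 g) (hh : S.MemL2 h) :
    inner ℝ (toUnitL2 hg) (toUnitL2 hh) = ∫ x in (0 : ℝ)..1, S.r x * g x * h x := by
  rw [← integral_unitInterval, L2.inner_def]
  refine integral_congr_ae ?_
  filter_upwards [coeFn_toUnitL2 hg, coeFn_toUnitL2 hh] with x h1 h2
  simp only [RCLike.inner_apply, conj_trivial, h1, h2]
  linear_combination g x * h x * Real.mul_self_sqrt (S.r_pos x x.2).le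

theorem norm_toUnitL2 (hg : S.MemL2 g) : ‖toUnitL2 hg‖ = S.norm g := by
  rw [norm_eq_sqrt_real_inner, inner_toUnitL2, SLData.norm]
  congr 1
  exact intervalIntegral.integral_congr fun x _ => by ring

theorem memL2_of_continuousOn (hg : ContinuousOn g (Icc 0 1)) : S.MemL2 g := by
  refine ⟨(hg.mono Ioc_subset_Icc_self).aestronglyMeasurable measurableSet_Ioc,
    ContinuousOn.intervalIntegrable ?_⟩
  rw [uIcc_of_le zero_le_one]
  exact S.r_continuousOn.mul (hg.pow 2)

theorem norm_nonneg' (g : ℝ → ℝ) : 0 ≤ S.norm g := Real.sqrt_nonneg _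

theorem norm_congr (hgh : EqOn g h (Icc 0 1)) : S.norm g = S.norm h := by
  unfold SLData.norm
  congr 1
  refine intervalIntegral.integral_congr fun x hx => ?_
  rw [uIcc_of_le zero_le_one] at hx
  simp only [hgh hx]

/-! ### The inverse of `A` -/

namespace IsFundamental

variable {v₁ v₂ : ℝ → ℝ} {W : ℝ}

/-- The symmetrized Green's function. -/
def kernel (hF : S.IsFundamental v₁ v₂ W) : C(unitInterval × unitInterval, ℝ) where
  toFun z := -(1 / W) * (Real.sqrt (S.r z.1) * Real.sqrt (S.r z.2)) *
    (v₁ (min z.1 z.2 : unitInterval) * v₂ (max z.1 z.2 : unitInterval))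
  continuous_toFun := by
    have h1 : Continuous fun x : unitInterval => v₁ x :=
      continuousOn_iff_continuous_domRestrict.1 hF.contDiffOn₁.continuousOn
    have h2 : Continuous fun x : unitInterval => v₂ x :=
      continuousOn_iff_continuous_domRestrict.1 hF.contDiffOn₂.continuousOn
    have h3 := continuous_sqrt_r (S := S)
    exact (continuous_const.mul ((h3.comp continuous_fst).mul (h3.comp continuous_snd))).mul
      ((h1.comp (continuous_fst.min continuous_snd)).mul
        (h2.comp (continuous_fst.max continuous_snd)))

theorem kernel_symm (hF : S.IsFundamental v₁ v₂ W) (x y : unitInterval) :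
    hF.kernel (x, y) = hF.kernel (y, x) := by
  simp only [kernel, ContinuousMap.coe_mk, min_comm x y, max_comm x y]
  ring

/-- The factor √r(y) of the kernel and the √r(y) in front of g multiply to the weight r(y).
Splitting at y = x resolves the minimum and maximum into the two integrals of `greenSolution`. -/
theorem integral_kernel (hF : S.IsFundamental v₁ v₂ W) (hg : ContinuousOn g (Icc 0 1))
    (x : unitInterval) : ∫ y : unitInterval, hF.kernel (x, y) * (Real.sqrt (S.r y) * g y) =
      Real.sqrt (S.r x) * S.greenSolution v₁ v₂ W g x := by
  have hc : ∀ {v : ℝ → ℝ} {a b : ℝ}, ContDiffOn ℝ 2 v (Icc 0 1) → a ∈ Icc (0 : ℝ) 1 →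
      b ∈ Icc (0 : ℝ) 1 → IntervalIntegrable (fun y => v y * S.r y * g y) volume a b :=
    fun hv ha hb => (((hv.continuousOn.mul S.r_continuousOn).mul hg).mono
      (ordConnected_Icc.uIcc_subset ha hb)).intervalIntegrable
  have h00 : (0 : ℝ) ∈ Icc (0 : ℝ) 1 := left_mem_Icc.2 zero_le_one
  have h11 : (1 : ℝ) ∈ Icc (0 : ℝ) 1 := right_mem_Icc.2 zero_le_one
  set P : ℝ → ℝ := fun y => -(1 / W) * Real.sqrt (S.r x) *
    (v₁ (min (x : ℝ) y) * v₂ (max (x : ℝ) y) * S.r y * g y) with hP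
  have e1 : ∀ y : unitInterval, hF.kernel (x, y) * (Real.sqrt (S.r y) * g y) = P y := by
    intro y
    have hmin : ((min x y : unitInterval) : ℝ) = min (x : ℝ) y := (Subtype.mono_coe _).map_min
    have hmax : ((max x y : unitInterval) : ℝ) = max (x : ℝ) y := (Subtype.mono_coe _).map_max
    simp only [hP, kernel, ContinuousMap.coe_mk, hmin, hmax]
    linear_combination (-(1 / W) * Real.sqrt (S.r x) * v₁ (min (x : ℝ) y) * v₂ (max (x : ℝ) y) *
      g y) * Real.mul_self_sqrt (S.r_pos y y.2).le
  simp only [e1]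
  rw [integral_unitInterval]
  have c1 : EqOn P (fun y => (-(1 / W) * Real.sqrt (S.r x) * v₂ x) * (v₁ y * S.r y * g y))
      (uIcc 0 (x : ℝ)) := by
    intro y hy
    rw [uIcc_of_le x.2.1] at hy
    simp only [hP, min_eq_right hy.2, max_eq_left hy.2]
    ring
  have c2 : EqOn P (fun y => (-(1 / W) * Real.sqrt (S.r x) * v₁ x) * (v₂ y * S.r y * g y))
      (uIcc (x : ℝ) 1) := by
    intro y hy
    rw [uIcc_of_le x.2.2] at hy
    simp only [hP, min_eq_left hy.1, max_eq_right hy.1]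
    ring
  have i1 : IntervalIntegrable P volume 0 x :=
    ((hc hF.contDiffOn₁ h00 x.2).const_mul _).congr (fun y hy => (c1 (uIoc_subset_uIcc hy)).symm)
  have i2 : IntervalIntegrable P volume x 1 :=
    ((hc hF.contDiffOn₂ x.2 h11).const_mul _).congr (fun y hy => (c2 (uIoc_subset_uIcc hy)).symm)
  rw [← intervalIntegral.integral_add_adjacent_intervals i1 i2, intervalIntegral.integral_congr c1,
    intervalIntegral.integral_congr c2, intervalIntegral.integral_const_mul,
    intervalIntegral.integral_const_mul, greenSolution]
  ring

theorem kernelMap_kernel (hF : S.IsFundamental v₁ v₂ W) (hg : ContinuousOn g (Icc 0 1))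
    (hg' : S.MemL2 g) (x : unitInterval) :
    kernelMap hF.kernel (toUnitL2 hg') x = Real.sqrt (S.r x) * S.greenSolution v₁ v₂ W g x := by
  rw [← hF.integral_kernel hg, kernelMap_apply]
  refine integral_congr_ae ?_
  filter_upwards [coeFn_toUnitL2 hg'] with y hy
  rw [hy]

end IsFundamental

end SLData

/-! ### Completeness of the eigenfunctions -/

namespace SLData

variable {S : SLData} {g h : ℝ → ℝ}

theorem toUnitL2_congr (hg : S.MemL2 g) {x : UnitL2}
    (hx : x =ᵐ[volume] fun x : unitInterval => Real.sqrt (S.r x) * g x) : x = toUnitL2 hg :=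
  Lp.ext (hx.trans (coeFn_toUnitL2 hg).symm)

namespace IsFundamental

variable {v₁ v₂ : ℝ → ℝ} {W : ℝ}

theorem kernelOperator_kernel (hF : S.IsFundamental v₁ v₂ W) (hg : ContinuousOn g (Icc 0 1))
    (hg' : S.MemL2 g) (hh : S.MemL2 h) (hgh : EqOn (S.greenSolution v₁ v₂ W g) h (Icc 0 1)) :
    kernelOperator hF.kernel (toUnitL2 hg') = toUnitL2 hh := by
  refine toUnitL2_congr hh ?_
  filter_upwards [BoundedContinuousFunction.coeFn_toLp (p := 2) (𝕜 := ℝ)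
    (volume : Measure unitInterval) (kernelMap hF.kernel (toUnitL2 hg'))] with x hx
  rw [← hgh x.2, ← hF.kernelMap_kernel hg hg']
  exact hx

/-- Test functions on (0,1) lie in the domain of A. -/
theorem bc_of_tsupport {ψ : ℝ → ℝ} (hψ : tsupport ψ ⊆ Ioo 0 1) :
    S.bc0 ψ = 0 ∧ S.bc1 ψ = 0 := by
  have key : ∀ x ∈ Icc (0 : ℝ) 1, x ∉ Ioo (0 : ℝ) 1 → ψ x = 0 ∧ dx ψ x = 0 := by
    intro x hx hn
    have h1 : ψ =ᶠ[𝓝 x] 0 := notMem_tsupport_iff_eventuallyEq.1 fun h => hn (hψ h)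
    refine ⟨h1.eq_of_nhds, ?_⟩
    have h2 : HasDerivAt ψ 0 x := (hasDerivAt_const x (0 : ℝ)).congr_of_eventuallyEq h1
    exact h2.hasDerivWithinAt.dx_eq hx
  obtain ⟨a1, a2⟩ := key 0 (by simp) (by simp)
  obtain ⟨a3, a4⟩ := key 1 (by simp) (by simp)
  simp [bc0, bc1, a1, a2, a3, a4]

/-- The range of the operator T contains √r ψ = T(√r A ψ) for every test function ψ. If T G = 0,
symmetry gives ⟪G, √r ψ⟫ = ⟪T G, √r A ψ⟫ = 0 for all ψ, so √r G vanishes almost everywhere. -/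
theorem kernelOperator_injective (hF : S.IsFundamental v₁ v₂ W) (h0 : ¬ S.IsEigenvalue 0)
    {G : UnitL2} (hG : kernelOperator hF.kernel G = 0) : G = 0 := by
  set E : ℝ → ℝ := Function.extend Subtype.val G 0 with hE
  have hEG : ∀ x : unitInterval, E x = G x := fun x => Subtype.val_injective.extend_apply _ _ x
  have hint : IntegrableOn (fun x => Real.sqrt (S.r x) * E x) (Icc 0 1) := by
    rw [← intervalIntegrable_iff_integrableOn_Icc_of_le zero_le_one, ← integrable_unitInterval_iff]
    simp only [hEG]
    let R : C(unitInterval, ℝ) := ⟨_, continuous_sqrt_r (S := S)⟩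
    exact (UnitL2.integrable G).bdd_mul R.continuous.aestronglyMeasurable
      (Eventually.of_forall fun z => R.norm_coe_le_norm z)
  have key := isOpen_Ioo.ae_eq_zero_of_integral_contDiff_smul_eq_zero
    (hint.mono_set Ioo_subset_Icc_self).locallyIntegrableOn (fun ψ hψ _ hsupp => ?_)
  · have hE0 : ∀ᵐ x ∂(volume.restrict (Icc (0 : ℝ) 1)), E x = 0 := by
      rw [← restrict_Ioo_eq_restrict_Icc, ae_restrict_iff' measurableSet_Ioo]
      filter_upwards [key] with x hx hmem
      have := hx hmem
      have hr : Real.sqrt (S.r x) ≠ 0 :=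
        (Real.sqrt_pos.2 (S.r_pos x (Ioo_subset_Icc_self hmem))).ne'
      simpa [hr] using this
    refine Lp.ext ?_
    filter_upwards [unitInterval.measurePreserving_coe.quasiMeasurePreserving.ae hE0,
      Lp.coeFn_zero ℝ 2 (volume : Measure unitInterval)] with x hx hz
    rw [← hEG, hx, hz]
    rfl
  · have hψ2 : ContDiff ℝ 2 ψ := contDiff_infty.1 hψ 2
    have hψc : ContDiffOn ℝ 2 ψ (Icc 0 1) := hψ2.contDiffOn
    obtain ⟨b0, b1⟩ := bc_of_tsupport (S := S) hsupp
    have hA := continuousOn_A (S := S) hψc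
    have hT := hF.kernelOperator_kernel hA (memL2_of_continuousOn hA)
      (memL2_of_continuousOn hψc.continuousOn) (hF.greenSolution_A h0 hψc b0 b1)
    have hs := kernelOperator_isSymmetric hF.kernel_symm G
      (toUnitL2 (S := S) (memL2_of_continuousOn hA))
    change inner ℝ (kernelOperator hF.kernel G) _ = inner ℝ G (kernelOperator hF.kernel _) at hs
    rw [hG, hT, inner_zero_left, L2.inner_def] at hs
    have e : ∫ x : unitInterval, ψ x • (Real.sqrt (S.r x) * E x) = 0 := by
      rw [hs]
      refine integral_congr_ae ?_
      filter_upwards [coeFn_toUnitL2 (S := S) (memL2_of_continuousOn hψc.continuousOn)] with x hx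
      simp only [RCLike.inner_apply, conj_trivial, hx, hEG, smul_eq_mul]
      ring
    rw [integral_unitInterval (fun x => ψ x • (Real.sqrt (S.r x) * E x)),
      intervalIntegral.integral_of_le zero_le_one] at e
    rw [← e]
    refine (setIntegral_eq_integral_of_forall_compl_eq_zero fun x hx => ?_).symm
    have : ψ x = 0 := by
      by_contra hn
      exact hx (Ioo_subset_Ioc_self (hsupp (subset_tsupport _ hn)))
    rw [this, zero_smul]

end IsFundamental

namespace IsEigensystem

variable {lam : ℕ → ℝ} {φ : ℕ → ℝ → ℝ}

/-- Both sides of the eigenvalue equation are continuous, so it extends from (0,1) to the end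
points. -/
theorem A_eq_on_Icc (hsys : S.IsEigensystem lam φ) (n : ℕ) {x : ℝ} (hx : x ∈ Icc (0 : ℝ) 1) :
    S.A (φ n) x = lam n * φ n x := by
  have h : EqOn (S.A (φ n)) (fun x => lam n * φ n x) (Icc 0 1) :=
    EqOn.of_subset_closure (s := Ioo 0 1) (fun x hx => hsys.eigen n x hx)
      (continuousOn_A (hsys.contDiffOn n))
      (continuousOn_const.mul (hsys.contDiffOn n).continuousOn) Ioo_subset_Icc_self
      (by rw [closure_Ioo zero_ne_one])
  exact h hx

theorem memL2 (hsys : S.IsEigensystem lam φ) (n : ℕ) : S.MemL2 (φ n) :=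
  memL2_of_continuousOn (hsys.contDiffOn n).continuousOn

theorem bc0_eq (hsys : S.IsEigensystem lam φ) (n : ℕ) : S.bc0 (φ n) = 0 := (hsys.inDomain n).2.1

theorem bc1_eq (hsys : S.IsEigensystem lam φ) (n : ℕ) : S.bc1 (φ n) = 0 := (hsys.inDomain n).2.2

/-- Green's formula against an eigenfunction. -/
theorem integral_mul_A (hsys : S.IsEigensystem lam φ) (n : ℕ) (hg : ContDiffOn ℝ 2 g (Icc 0 1)) :
    ∫ x in (0 : ℝ)..1, S.r x * φ n x * S.A g x =
      lam n * (∫ x in (0 : ℝ)..1, S.r x * φ n x * g x) + S.p 1 * S.trace₁ (φ n) * S.bc1 g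
        - S.p 0 * S.trace₀ (φ n) * S.bc0 g := by
  rw [SLData.integral_mul_A (hsys.contDiffOn n) (hsys.bc0_eq n) (hsys.bc1_eq n) hg,
    ← intervalIntegral.integral_const_mul]
  congr 2
  refine intervalIntegral.integral_congr fun x hx => ?_
  rw [uIcc_of_le zero_le_one] at hx
  simp only [hsys.A_eq_on_Icc n hx]
  ring

/-- Green's formula for two eigenfunctions gives (λₙ - λₘ) ∫ r φₘ φₙ = 0, and the eigenvalues are
distinct. -/
theorem orthonormal (hsys : S.IsEigensystem lam φ) :
    Orthonormal ℝ fun n => toUnitL2 (hsys.memL2 n) := by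
  refine ⟨fun n => by rw [norm_toUnitL2, hsys.normalized n], fun m n hmn => ?_⟩
  simp only [inner_toUnitL2]
  have h := hsys.integral_mul_A m (hsys.contDiffOn n)
  rw [hsys.bc0_eq n, hsys.bc1_eq n] at h
  have e : ∫ x in (0 : ℝ)..1, S.r x * φ m x * S.A (φ n) x =
      lam n * ∫ x in (0 : ℝ)..1, S.r x * φ m x * φ n x := by
    rw [← intervalIntegral.integral_const_mul]
    refine intervalIntegral.integral_congr fun x hx => ?_
    rw [uIcc_of_le zero_le_one] at hx
    simp only [hsys.A_eq_on_Icc n hx]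
    ring
  rw [e] at h
  have hne : lam n - lam m ≠ 0 := sub_ne_zero.2 (hsys.strictMono.injective.ne hmn.symm)
  have : (lam n - lam m) * ∫ x in (0 : ℝ)..1, S.r x * φ m x * φ n x = 0 := by
    linear_combination h
  exact (mul_eq_zero.1 this).resolve_left hne

theorem not_isEigenvalue_zero (hsys : S.IsEigensystem lam φ) (hpos : 0 < lam 0) :
    ¬ S.IsEigenvalue 0 := by
  rw [hsys.isEigenvalue_iff]
  rintro ⟨n, hn⟩
  exact (hpos.trans_le (hsys.strictMono.monotone (Nat.zero_le n))).ne' hn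

theorem exists_ne_zero (hsys : S.IsEigensystem lam φ) (n : ℕ) :
    ∃ x ∈ Icc (0 : ℝ) 1, φ n x ≠ 0 := by
  by_contra! hcon
  have h1 := hsys.normalized n
  have h2 : S.norm (φ n) = S.norm fun _ => 0 := norm_congr fun x hx => hcon x hx
  rw [h2] at h1
  simp [SLData.norm] at h1

/-- Every eigenvector of the inverse operator is a multiple of an eigenfunction. -/
theorem eigenvector_mem_span (hsys : S.IsEigensystem lam φ) {v₁ v₂ : ℝ → ℝ} {W : ℝ}
    (hF : S.IsFundamental v₁ v₂ W) {μ : ℝ} (hμ : μ ≠ 0) {G : UnitL2}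
    (hG : kernelOperator hF.kernel G = μ • G) :
    G ∈ Submodule.span ℝ (range fun n => toUnitL2 (hsys.memL2 n)) := by
  -- Since G = μ⁻¹ T G and T takes continuous values, this is a continuous representative of G / √r.
  set g : ℝ → ℝ := IccExtend zero_le_one
    (fun x : unitInterval => μ⁻¹ * kernelMap hF.kernel G x / Real.sqrt (S.r x)) with hg
  have hsr : ∀ x : unitInterval, Real.sqrt (S.r x) ≠ 0 := fun x =>
    (Real.sqrt_pos.2 (S.r_pos x x.2)).ne'
  have hgx : ∀ x : unitInterval, g x = μ⁻¹ * kernelMap hF.kernel G x / Real.sqrt (S.r x) :=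
    fun x => IccExtend_val _ _ x
  have hgc : ContinuousOn g (Icc 0 1) := by
    refine Continuous.continuousOn (Continuous.Icc_extend' ?_)
    exact (continuous_const.mul (kernelMap hF.kernel G).continuous).div
      (continuous_sqrt_r (S := S)) hsr
  have hgm : S.MemL2 g := memL2_of_continuousOn hgc
  have hGg : G = toUnitL2 hgm := by
    refine toUnitL2_congr hgm ?_
    have h1 : kernelOperator hF.kernel G =ᵐ[volume] kernelMap hF.kernel G :=
      BoundedContinuousFunction.coeFn_toLp (p := 2) (𝕜 := ℝ) _ _
    have h2 := Lp.coeFn_smul μ G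
    rw [hG] at h1
    filter_upwards [h1, h2] with x e1 e2
    rw [e2, Pi.smul_apply, smul_eq_mul] at e1
    have := hsr x
    rw [hgx, ← e1]
    field_simp
  obtain ⟨c1, c2, c3, c4⟩ := hF.greenSolution_spec hgc
  set y := S.greenSolution v₁ v₂ W g with hy
  have hyg : ∀ x ∈ Icc (0 : ℝ) 1, g x = μ⁻¹ * y x := by
    intro x hx
    have e := hF.kernelMap_kernel hgc hgm ⟨x, hx⟩
    rw [← hGg] at e
    have := hsr ⟨x, hx⟩
    rw [hgx ⟨x, hx⟩, e]
    field_simp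
    rfl
  -- Here A y = g because y is the Green solution for g, while g = μ⁻¹ y by the eigenvector
  -- equation.
  have hyA : ∀ x ∈ Icc (0 : ℝ) 1, S.A y x = μ⁻¹ * y x := fun x hx => by
    rw [c2 x hx, hyg x hx]
  by_cases hev : S.IsEigenvalue μ⁻¹
  · obtain ⟨n, hn⟩ := (hsys.isEigenvalue_iff _).1 hev
    -- Eigenvalues are simple: the condition at 0 fixes a solution up to a factor.
    obtain ⟨c, hc⟩ := eq_smul_of_bc0 c1 (hsys.contDiffOn n) hyA
      (fun x hx => by rw [← hn]; exact hsys.A_eq_on_Icc n hx) c3 (hsys.bc0_eq n)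
      (hsys.exists_ne_zero n)
    have : G = (μ⁻¹ * c) • toUnitL2 (hsys.memL2 n) := by
      rw [hGg]
      refine (toUnitL2_congr hgm ?_).symm
      filter_upwards [Lp.coeFn_smul (μ⁻¹ * c) (toUnitL2 (hsys.memL2 n)),
        coeFn_toUnitL2 (hsys.memL2 n)] with x e1 e2
      rw [e1, Pi.smul_apply, e2, hyg x x.2, hc x x.2, smul_eq_mul]
      ring
    rw [this]
    exact Submodule.smul_mem _ _ (Submodule.subset_span ⟨n, rfl⟩)
  · have hy0 := fun x hx => eq_zero_of_not_isEigenvalue (x := x) hev c1 c3 c4 hyA hx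
    have : G = 0 := by
      rw [hGg]
      refine (toUnitL2_congr hgm ?_).symm
      filter_upwards [Lp.coeFn_zero ℝ 2 (volume : Measure unitInterval)] with x e1
      rw [e1, hyg x x.2, hy0 x x.2, mul_zero, mul_zero]
      rfl
    rw [this]
    exact Submodule.zero_mem _

/-- The eigenspaces of a compact symmetric operator have no common orthogonal vector other than 0.
Each is contained in the span: for μ ≠ 0 by `eigenvector_mem_span`, for μ = 0 by injectivity. -/
theorem span_orthogonal_eq_bot (hsys : S.IsEigensystem lam φ) (hpos : 0 < lam 0) :
    (Submodule.span ℝ (range fun n => toUnitL2 (hsys.memL2 n)))ᗮ = ⊥ := by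
  have h0 := hsys.not_isEigenvalue_zero hpos
  obtain ⟨v₁, v₂, W, hF⟩ := exists_isFundamental h0
  have h := ContinuousLinearMap.orthogonalComplement_iSup_eigenspaces_eq_bot
    (isCompactOperator_kernelOperator hF.kernel) (kernelOperator_isSymmetric hF.kernel_symm)
  rw [eq_bot_iff, ← h]
  refine Submodule.orthogonal_le (iSup_le fun μ G hG => ?_)
  have hG' : kernelOperator hF.kernel G = μ • G := Module.End.mem_eigenspace_iff.1 hG
  rcases eq_or_ne μ 0 with rfl | hμ
  · rw [zero_smul] at hG'
    rw [hF.kernelOperator_injective h0 hG']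
    exact Submodule.zero_mem _
  · exact hsys.eigenvector_mem_span hF hμ hG'

/-- Parseval's identity for the eigenfunctions. -/
theorem hasSum_coeff_sq (hsys : S.IsEigensystem lam φ) (hpos : 0 < lam 0) (hg : S.MemL2 g) :
    HasSum (fun n => (∫ x in (0 : ℝ)..1, S.r x * φ n x * g x) ^ 2) (S.norm g ^ 2) := by
  have h := (HilbertBasis.mkOfOrthogonalEqBot hsys.orthonormal
    (hsys.span_orthogonal_eq_bot hpos)).hasSum_inner_mul_inner (toUnitL2 hg) (toUnitL2 hg)
  rw [HilbertBasis.coe_mkOfOrthogonalEqBot, real_inner_self_eq_norm_sq, norm_toUnitL2] at h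
  convert! h using 2 with n
  rw [real_inner_comm, inner_toUnitL2, sq]

end IsEigensystem

end SLData

/-! ### Stationary problems and the gains -/

namespace SLData

variable {S : SLData}

theorem solvesBVP_iff {β₀ β₁ : ℝ} {v : ℝ → ℝ} : S.SolvesBVP β₀ β₁ v ↔
    ContDiffOn ℝ 2 v (Icc 0 1) ∧ (∀ x ∈ Icc (0 : ℝ) 1, S.A v x = 0) ∧
      S.bc0 v = β₀ ∧ S.bc1 v = β₁ := by
  refine and_congr_right fun _ => and_congr_left fun _ => forall₂_congr fun x hx => ?_
  rw [A_eq_zero_iff v hx, sub_eq_zero]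
  rfl

/-- In the fundamental system v₁ affects only the boundary value at 1 and v₂ only the one at 0, so
the two coefficients can be read off separately. -/
theorem exists_isUniqueBVPSolution (h0 : ¬ S.IsEigenvalue 0) (β₀ β₁ : ℝ) :
    ∃ v, S.IsUniqueBVPSolution β₀ β₁ v := by
  obtain ⟨v₁, v₂, W, hF⟩ := exists_isFundamental h0
  have hA₁ : ∀ x ∈ Icc (0 : ℝ) 1, S.A v₁ x = 0 := fun x hx => (A_eq_zero_iff v₁ hx).2 (hF.ode₁ x hx)
  have hA₂ : ∀ x ∈ Icc (0 : ℝ) 1, S.A v₂ x = 0 := fun x hx => (A_eq_zero_iff v₂ hx).2 (hF.ode₂ x hx)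
  have hv : S.SolvesBVP β₀ β₁ fun x => β₁ / S.bc1 v₁ * v₁ x + β₀ / S.bc0 v₂ * v₂ x := by
    refine solvesBVP_iff.2 ⟨contDiffOn_lin hF.contDiffOn₁ hF.contDiffOn₂ _ _, fun x hx => ?_, ?_, ?_⟩
    · rw [A_lin hF.contDiffOn₁ hF.contDiffOn₂ _ _ hx, hA₁ x hx, hA₂ x hx]
      ring
    · rw [bc0_lin hF.contDiffOn₁ hF.contDiffOn₂, hF.bc0₁, mul_zero, zero_add,
        div_mul_cancel₀ _ hF.bc0₂]
    · rw [bc1_lin hF.contDiffOn₁ hF.contDiffOn₂, hF.bc1₂, mul_zero, add_zero,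
        div_mul_cancel₀ _ hF.bc1₁]
  refine ⟨_, hv, fun w hw x hx => ?_⟩
  obtain ⟨p1, p2, p3, p4⟩ := solvesBVP_iff.1 hv
  obtain ⟨w1, w2, w3, w4⟩ := solvesBVP_iff.1 hw
  have := eq_zero_of_not_isEigenvalue h0 (contDiffOn_lin w1 p1 1 (-1))
    (by rw [bc0_lin w1 p1, w3, p3]; ring) (by rw [bc1_lin w1 p1, w4, p4]; ring)
    (fun y hy => by rw [A_lin w1 p1 _ _ hy, w2 y hy, p2 y hy]; ring) hx
  linarith

namespace IsEigensystem

variable {lam : ℕ → ℝ} {φ : ℕ → ℝ → ℝ}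

theorem lam_pos (hsys : S.IsEigensystem lam φ) (hpos : 0 < lam 0) (n : ℕ) : 0 < lam n :=
  hpos.trans_le (hsys.strictMono.monotone (Nat.zero_le n))

/-- Green's formula with A v = 0. It links the series for the gains to the stationary problems. -/
theorem coeff_of_solvesBVP (hsys : S.IsEigensystem lam φ) {β₀ β₁ : ℝ} {v : ℝ → ℝ}
    (hv : S.SolvesBVP β₀ β₁ v) (n : ℕ) :
    lam n * ∫ x in (0 : ℝ)..1, S.r x * φ n x * v x =
      S.p 0 * S.trace₀ (φ n) * β₀ - S.p 1 * S.trace₁ (φ n) * β₁ := by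
  obtain ⟨h1, h2, h3, h4⟩ := solvesBVP_iff.1 hv
  have h := hsys.integral_mul_A n h1
  have e : ∫ x in (0 : ℝ)..1, S.r x * φ n x * S.A v x = 0 := by
    have hz : EqOn (fun x => S.r x * φ n x * S.A v x) (fun _ => 0) (uIcc 0 1) := fun x hx => by
      rw [uIcc_of_le zero_le_one] at hx
      simp only [h2 x hx, mul_zero]
    rw [intervalIntegral.integral_congr hz, intervalIntegral.integral_zero]
  rw [e, h3, h4] at h
  linarith

/-- By `coeff_of_solvesBVP` each gain term is (b₁² + b₂²)/p(0)² times the square of a Fourier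
coefficient of v, and Parseval sums these squares. -/
theorem hasSum_gainTerm₀ (hsys : S.IsEigensystem lam φ) (hpos : 0 < lam 0) {v : ℝ → ℝ}
    (hv : S.SolvesBVP (Real.sqrt (S.b₁ ^ 2 + S.b₂ ^ 2)) 0 v) :
    HasSum (S.gainTerm₀ lam φ) ((S.b₁ ^ 2 + S.b₂ ^ 2) / S.p 0 ^ 2 * S.norm v ^ 2) := by
  have h := (hsys.hasSum_coeff_sq hpos (memL2_of_continuousOn hv.1.continuousOn)).mul_left
    ((S.b₁ ^ 2 + S.b₂ ^ 2) / S.p 0 ^ 2)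
  convert! h using 2 with n
  have hl := (hsys.lam_pos hpos n).ne'
  have hp := S.p_ne_zero (left_mem_Icc.2 zero_le_one)
  have hb := S.b_sq_pos
  have e := hsys.coeff_of_solvesBVP hv n
  have e' : (∫ x in (0 : ℝ)..1, S.r x * φ n x * v x) =
      S.p 0 * S.trace₀ (φ n) * Real.sqrt (S.b₁ ^ 2 + S.b₂ ^ 2) / lam n := by
    rw [eq_div_iff hl]; linarith
  rw [e', div_pow, mul_pow, Real.sq_sqrt hb.le, gainTerm₀, sq_abs, trace₀]
  field_simp

theorem hasSum_gainTerm₁ (hsys : S.IsEigensystem lam φ) (hpos : 0 < lam 0) {v : ℝ → ℝ}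
    (hv : S.SolvesBVP 0 (Real.sqrt (S.a₁ ^ 2 + S.a₂ ^ 2)) v) :
    HasSum (S.gainTerm₁ lam φ) ((S.a₁ ^ 2 + S.a₂ ^ 2) / S.p 1 ^ 2 * S.norm v ^ 2) := by
  have h := (hsys.hasSum_coeff_sq hpos (memL2_of_continuousOn hv.1.continuousOn)).mul_left
    ((S.a₁ ^ 2 + S.a₂ ^ 2) / S.p 1 ^ 2)
  convert! h using 2 with n
  have hl := (hsys.lam_pos hpos n).ne'
  have hp := S.p_ne_zero (right_mem_Icc.2 zero_le_one)
  have ha := S.a_sq_pos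
  have e := hsys.coeff_of_solvesBVP hv n
  have e' : (∫ x in (0 : ℝ)..1, S.r x * φ n x * v x) =
      -(S.p 1 * S.trace₁ (φ n)) * Real.sqrt (S.a₁ ^ 2 + S.a₂ ^ 2) / lam n := by
    rw [eq_div_iff hl]; linarith
  rw [e', div_pow, mul_pow, Real.sq_sqrt ha.le, gainTerm₁, sq_abs, trace₁]
  field_simp
  ring

theorem sqrt_gain {p b N : ℝ} (hp : 0 < p) (hb : 0 < b) (hN : 0 ≤ N) :
    p / b * Real.sqrt (b / p ^ 2 * N ^ 2) = 1 / Real.sqrt b * N := by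
  rw [Real.sqrt_mul (by positivity), Real.sqrt_div hb.le, Real.sqrt_sq hp.le, Real.sqrt_sq hN]
  have hs : Real.sqrt b ≠ 0 := (Real.sqrt_pos.2 hb).ne'
  have h2 := Real.mul_self_sqrt hb.le
  field_simp
  linear_combination N * h2

theorem C₀_eq (hsys : S.IsEigensystem lam φ) (hpos : 0 < lam 0) {v : ℝ → ℝ}
    (hv : S.SolvesBVP (Real.sqrt (S.b₁ ^ 2 + S.b₂ ^ 2)) 0 v) :
    S.C₀ lam φ = 1 / Real.sqrt (S.b₁ ^ 2 + S.b₂ ^ 2) * S.norm v := by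
  rw [C₀, (hsys.hasSum_gainTerm₀ hpos hv).tsum_eq]
  exact sqrt_gain (S.p_pos 0 (left_mem_Icc.2 zero_le_one)) S.b_sq_pos (norm_nonneg' v)

theorem C₁_eq (hsys : S.IsEigensystem lam φ) (hpos : 0 < lam 0) {v : ℝ → ℝ}
    (hv : S.SolvesBVP 0 (Real.sqrt (S.a₁ ^ 2 + S.a₂ ^ 2)) v) :
    S.C₁ lam φ = 1 / Real.sqrt (S.a₁ ^ 2 + S.a₂ ^ 2) * S.norm v := by
  rw [C₁, (hsys.hasSum_gainTerm₁ hpos hv).tsum_eq]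
  exact sqrt_gain (S.p_pos 1 (right_mem_Icc.2 zero_le_one)) S.a_sq_pos (norm_nonneg' v)

theorem C₀_nonneg : 0 ≤ S.C₀ lam φ :=
  mul_nonneg (div_nonneg (S.p_pos 0 (left_mem_Icc.2 zero_le_one)).le S.b_sq_pos.le)
    (Real.sqrt_nonneg _)

theorem C₁_nonneg : 0 ≤ S.C₁ lam φ :=
  mul_nonneg (div_nonneg (S.p_pos 1 (right_mem_Icc.2 zero_le_one)).le S.a_sq_pos.le)
    (Real.sqrt_nonneg _)

/-- The form in which C₀ enters the estimate: an ℓ² bound on the factors of d₀ in the modal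
equations, divided by the eigenvalues. -/
theorem sum_trace₀_sq_le (hsum : Summable (S.gainTerm₀ lam φ)) (N : ℕ) :
    ∑ n ∈ Finset.range N, (|S.p 0 * S.trace₀ (φ n)| / lam n) ^ 2 ≤ S.C₀ lam φ ^ 2 := by
  have h0 : ∀ n, 0 ≤ S.gainTerm₀ lam φ n := fun n => by unfold gainTerm₀; positivity
  have hb := S.b_sq_pos.ne'
  rw [C₀, mul_pow, Real.sq_sqrt (tsum_nonneg h0)]
  refine le_trans (le_of_eq ?_)
    (mul_le_mul_of_nonneg_left (hsum.sum_le_tsum (Finset.range N) fun n _ => h0 n) (sq_nonneg _))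
  rw [Finset.mul_sum]
  refine Finset.sum_congr rfl fun n _ => ?_
  rw [div_pow, sq_abs, gainTerm₀, sq_abs, trace₀]
  field_simp

theorem sum_trace₁_sq_le (hsum : Summable (S.gainTerm₁ lam φ)) (N : ℕ) :
    ∑ n ∈ Finset.range N, (|S.p 1 * S.trace₁ (φ n)| / lam n) ^ 2 ≤ S.C₁ lam φ ^ 2 := by
  have h0 : ∀ n, 0 ≤ S.gainTerm₁ lam φ n := fun n => by unfold gainTerm₁; positivity
  have hb := S.a_sq_pos.ne'
  rw [C₁, mul_pow, Real.sq_sqrt (tsum_nonneg h0)]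
  refine le_trans (le_of_eq ?_)
    (mul_le_mul_of_nonneg_left (hsum.sum_le_tsum (Finset.range N) fun n _ => h0 n) (sq_nonneg _))
  rw [Finset.mul_sum]
  refine Finset.sum_congr rfl fun n _ => ?_
  rw [div_pow, sq_abs, gainTerm₁, sq_abs, trace₁,
    show S.a₂ * φ n 1 - S.a₁ * dx (φ n) 1 = -(S.a₁ * dx (φ n) 1 - S.a₂ * φ n 1) by ring, neg_sq]
  field_simp

end IsEigensystem

end SLData

/-! ### Regular times and bounds for the inputs -/

namespace IsTimeSequence

variable {τ : ℕ → ℝ}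

theorem nonneg (hτ : IsTimeSequence τ) (i : ℕ) : 0 ≤ τ i :=
  hτ.zero ▸ hτ.strictMono.monotone (Nat.zero_le i)

theorem Ioo_subset (hτ : IsTimeSequence τ) (i : ℕ) : Ioo (τ i) (τ (i + 1)) ⊆ regularTimes τ := by
  refine fun t ht => ⟨(hτ.nonneg i).trans ht.1.le, ?_⟩
  rintro ⟨k, rfl⟩
  have h1 := hτ.strictMono.lt_iff_lt.1 ht.1
  have h2 := hτ.strictMono.lt_iff_lt.1 ht.2
  omega

theorem exists_mem_Ioo (hτ : IsTimeSequence τ) {t : ℝ} (ht : t ∈ regularTimes τ) :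
    ∃ i, t ∈ Ioo (τ i) (τ (i + 1)) := by
  have hex : ∃ k, t < τ k := (hτ.tendsto.eventually_gt_atTop t).exists
  classical
  have h1 := Nat.find_spec hex
  have h0 : Nat.find hex ≠ 0 := fun h => by
    rw [h, hτ.zero] at h1
    exact absurd ht.1 (not_le.2 h1)
  obtain ⟨i, hi⟩ := Nat.exists_eq_succ_of_ne_zero h0
  refine ⟨i, lt_of_le_of_ne (not_lt.1 (Nat.find_min hex (by omega))) fun h => ht.2 ⟨i, h⟩, ?_⟩
  rwa [hi] at h1

theorem isOpen_regularTimes (hτ : IsTimeSequence τ) : IsOpen (regularTimes τ) := by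
  have : regularTimes τ = ⋃ i, Ioo (τ i) (τ (i + 1)) := by
    ext t
    rw [mem_iUnion]
    exact ⟨hτ.exists_mem_Ioo, fun ⟨i, hi⟩ => hτ.Ioo_subset i hi⟩
  rw [this]
  exact isOpen_iUnion fun i => isOpen_Ioo

theorem pos_of_mem (hτ : IsTimeSequence τ) {t : ℝ} (ht : t ∈ regularTimes τ) : 0 < t :=
  lt_of_le_of_ne ht.1 fun h => ht.2 ⟨0, hτ.zero.trans h⟩

/-- A function bounded between consecutive times is bounded on bounded time intervals. -/
theorem exists_bound (hτ : IsTimeSequence τ) {F : ℝ → ℝ}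
    (hF : ∀ i, ∃ M, ∀ s ∈ Ioo (τ i) (τ (i + 1)), F s ≤ M) (t : ℝ) :
    ∃ M, ∀ s ∈ Ioo 0 t, F s ≤ M := by
  choose M hM using hF
  obtain ⟨N, hN⟩ := (hτ.tendsto.eventually_gt_atTop t).exists
  -- Finitely many intervals meet (0, t). The values at the times τᵢ are added because the
  -- hypothesis says nothing about them.
  refine ⟨∑ i ∈ Finset.range N, (|M i| + |F (τ i)|), fun s hs => ?_⟩
  have hle : ∀ i < N, |M i| + |F (τ i)| ≤ ∑ i ∈ Finset.range N, (|M i| + |F (τ i)|) :=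
    fun i hi => Finset.single_le_sum (f := fun i => |M i| + |F (τ i)|)
      (fun j _ => by positivity) (Finset.mem_range.2 hi)
  by_cases hr : s ∈ range τ
  · obtain ⟨k, rfl⟩ := hr
    have hk : k < N := hτ.strictMono.lt_iff_lt.1 (hs.2.trans hN)
    refine le_trans ?_ (hle k hk)
    linarith [le_abs_self (F (τ k)), abs_nonneg (M k)]
  · obtain ⟨i, hi⟩ := hτ.exists_mem_Ioo (t := s) ⟨hs.1.le, hr⟩
    have hk : i < N := hτ.strictMono.lt_iff_lt.1 (hi.1.trans (hs.2.trans hN))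
    refine le_trans ?_ (hle i hk)
    linarith [le_abs_self (M i), abs_nonneg (F (τ i)), hM i s hi]

end IsTimeSequence

/-- Between consecutive times the derivative is bounded, so the mean value inequality from the
midpoint bounds d. -/
theorem IsGBWith.exists_bound {τ : ℕ → ℝ} {d : ℝ → ℝ} (hd : IsGBWith τ d) (hτ : IsTimeSequence τ)
    (t : ℝ) : ∃ M, ∀ s ∈ Ioo 0 t, |d s| ≤ M := by
  refine hτ.exists_bound (F := fun s => |d s|) (fun i => ?_) t
  obtain ⟨M, hM⟩ := hd.2.2.2 i
  have hlt : τ i < τ (i + 1) := hτ.strictMono (Nat.lt_succ_self i)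
  set m := (τ i + τ (i + 1)) / 2 with hm
  have hmm : m ∈ Ioo (τ i) (τ (i + 1)) := ⟨by linarith, by linarith⟩
  have hM0 : 0 ≤ M := (abs_nonneg _).trans (hM m hmm)
  refine ⟨|d m| + M * (τ (i + 1) - τ i), fun s hs => ?_⟩
  have hdiff : ∀ x ∈ Ioo (τ i) (τ (i + 1)), DifferentiableAt ℝ d x := fun x hx =>
    (hd.2.1.differentiableOn two_ne_zero).differentiableAt
      (hτ.isOpen_regularTimes.mem_nhds (hτ.Ioo_subset i hx))
  have h := (convex_Ioo (τ i) (τ (i + 1))).norm_image_sub_le_of_norm_deriv_le hdiff hM hmm hs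
  rw [Real.norm_eq_abs, Real.norm_eq_abs] at h
  have h1 : |d s| ≤ |d m| + |d s - d m| := by
    have := abs_add_le (d m) (d s - d m)
    rwa [add_sub_cancel] at this
  have h2 : |s - m| ≤ τ (i + 1) - τ i :=
    abs_le.2 ⟨by linarith [hs.1, hmm.2], by linarith [hs.2, hmm.1]⟩
  linarith [mul_le_mul_of_nonneg_left h2 hM0]

namespace SLData

variable {S : SLData} {g h : ℝ → ℝ} {τ : ℕ → ℝ} {f : ℝ → ℝ → ℝ}

theorem IsGDWith.continuousOn (hf : S.IsGDWith τ f) (hτ : IsTimeSequence τ) {t : ℝ}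
    (ht : t ∈ regularTimes τ) : ContinuousOn (f t) (Icc 0 1) := by
  obtain ⟨i, hi⟩ := hτ.exists_mem_Ioo ht
  obtain ⟨f₁, f₂, a, b, c, -, -, -, -, -, h, -⟩ := hf i
  obtain ⟨h1, ⟨-, h2⟩, h3⟩ := h t hi
  exact (h1.1.add h2.continuousOn).congr h3

theorem IsGDWith.exists_bound (hf : S.IsGDWith τ f) (hτ : IsTimeSequence τ) (t : ℝ) :
    ∃ M, ∀ s ∈ Ioo 0 t, S.norm (f s) ≤ M := by
  refine hτ.exists_bound (F := fun s => S.norm (f s)) (fun i => ?_) t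
  obtain ⟨f₁, f₂, a, b, c, -, -, -, -, -, h, ⟨M, hM⟩, -⟩ := hf i
  -- From (f₁ + f₂)² ≤ 2 (f₁² + f₂²), with the nonnegative term (A f₂)² added.
  refine ⟨Real.sqrt (2 * M), fun s hs => Real.sqrt_le_sqrt ?_⟩
  obtain ⟨h1, ⟨-, h2⟩, h3⟩ := h s hs
  refine le_trans ?_ (mul_le_mul_of_nonneg_left (hM s hs) zero_le_two)
  rw [← intervalIntegral.integral_const_mul]
  have hfc : ContinuousOn (f s) (Icc 0 1) := (h1.1.add h2.continuousOn).congr h3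
  refine intervalIntegral.integral_mono_on zero_le_one ?_ ?_ fun x hx => ?_
  · exact ContinuousOn.intervalIntegrable (by
      rw [uIcc_of_le zero_le_one]; exact S.r_continuousOn.mul (hfc.pow 2))
  · refine ContinuousOn.intervalIntegrable ?_
    rw [uIcc_of_le zero_le_one]
    exact continuousOn_const.mul (S.r_continuousOn.mul
      (((h1.1.pow 2).add (h2.continuousOn.pow 2)).add ((continuousOn_A h2).pow 2)))
  · rw [h3 x hx]
    nlinarith [S.r_pos x hx, mul_nonneg (S.r_pos x hx).le (sq_nonneg (f₁ s x - f₂ s x)),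
      mul_nonneg (S.r_pos x hx).le (sq_nonneg (S.A (f₂ s) x))]

theorem MemL2.sub (hg : S.MemL2 g) (hh : S.MemL2 h) : S.MemL2 fun x => g x - h x := by
  refine ⟨hg.1.sub hh.1, integrable_unitInterval_iff.1 ?_⟩
  refine (hg.memLp.sub hh.memLp).integrable_sq.congr (Eventually.of_forall fun x => ?_)
  simp only [Pi.sub_apply]
  linear_combination (g x - h x) ^ 2 * Real.sq_sqrt (S.r_pos x x.2).le

theorem toUnitL2_sub (hg : S.MemL2 g) (hh : S.MemL2 h) :
    toUnitL2 hg - toUnitL2 hh = toUnitL2 (hg.sub hh) := by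
  refine toUnitL2_congr _ ?_
  filter_upwards [Lp.coeFn_sub (toUnitL2 hg) (toUnitL2 hh), coeFn_toUnitL2 hg,
    coeFn_toUnitL2 hh] with x e1 e2 e3
  rw [e1, Pi.sub_apply, e2, e3]
  ring

theorem abs_integral_mul_le (hg : S.MemL2 g) (hh : S.MemL2 h) :
    |∫ x in (0 : ℝ)..1, S.r x * g x * h x| ≤ S.norm g * S.norm h := by
  rw [← inner_toUnitL2 hg hh, ← norm_toUnitL2 hg, ← norm_toUnitL2 hh]
  exact abs_real_inner_le_norm _ _

/-! ### The modal equations -/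

namespace IsSolutionWith

variable {u₀ d₀ d₁ : ℝ → ℝ} {u : ℝ → ℝ → ℝ}

theorem continuousOn_coeff (hu : S.IsSolutionWith τ u₀ f d₀ d₁ u) {φ : ℝ → ℝ} (hφ : S.MemL2 φ) :
    ContinuousOn (fun s => ∫ x in (0 : ℝ)..1, S.r x * φ x * u s x) (Ici 0) := by
  intro t ht
  have hz : Tendsto (fun s => S.norm φ * S.norm fun x => u s x - u t x) (𝓝[Ici 0] t) (𝓝 0) := by
    simpa using (hu.continuous_L2 t ht).const_mul (S.norm φ)
  refine tendsto_iff_dist_tendsto_zero.2 (squeeze_zero' (Eventually.of_forall fun _ => dist_nonneg)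
    ?_ hz)
  filter_upwards [self_mem_nhdsWithin] with s hs
  rw [Real.dist_eq, ← inner_toUnitL2 hφ (hu.memL2 s hs), ← inner_toUnitL2 hφ (hu.memL2 t ht),
    ← inner_sub_right, toUnitL2_sub, inner_toUnitL2]
  exact abs_integral_mul_le hφ ((hu.memL2 s hs).sub (hu.memL2 t ht))

/-- A jointly continuous version of the time derivative, bounded on compact sets, as needed to
differentiate under the integral. -/
theorem hasDerivAt_time (hu : S.IsSolutionWith τ u₀ f d₀ d₁ u) (hτ : IsTimeSequence τ) :
    ∃ U : ℝ × ℝ → ℝ, ContinuousOn U (regularTimes τ ×ˢ Icc (0 : ℝ) 1) ∧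
      ∀ t ∈ regularTimes τ, ∀ x ∈ Icc (0 : ℝ) 1, HasDerivAt (fun s => u s x) (U (t, x)) t := by
  have hopen := hτ.isOpen_regularTimes
  have hud : UniqueDiffOn ℝ (regularTimes τ ×ˢ Icc (0 : ℝ) 1) :=
    hopen.uniqueDiffOn.prod uniqueDiffOn_unit
  refine ⟨fun z => fderivWithin ℝ (Function.uncurry u) (regularTimes τ ×ˢ Icc (0 : ℝ) 1) z (1, 0),
    ?_, fun t ht x hx => ?_⟩
  · exact (hu.contDiffOn.continuousOn_fderivWithin hud le_rfl).clm_apply continuousOn_const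
  · have h1 := ((hu.contDiffOn.differentiableOn one_ne_zero) (t, x) ⟨ht, hx⟩).hasFDerivWithinAt
    have h2 : HasDerivWithinAt (fun s : ℝ => (s, x)) (1, 0) (regularTimes τ) t :=
      ((hasDerivAt_id t).prodMk (hasDerivAt_const t x)).hasDerivWithinAt
    have h3 := h1.comp_hasDerivWithinAt t h2 (fun s hs => mk_mem_prod hs hx)
    exact h3.hasDerivAt (hopen.mem_nhds ht)

theorem hasDerivAt_coeff (hu : S.IsSolutionWith τ u₀ f d₀ d₁ u) (hτ : IsTimeSequence τ)
    {φ : ℝ → ℝ} (hφ : ContinuousOn φ (Icc 0 1)) {t : ℝ} (ht : t ∈ regularTimes τ) :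
    HasDerivAt (fun s => ∫ x in (0 : ℝ)..1, S.r x * φ x * u s x)
      (∫ x in (0 : ℝ)..1, S.r x * φ x * deriv (fun s => u s x) t) t := by
  obtain ⟨U, hUc, hU⟩ := hu.hasDerivAt_time hτ
  obtain ⟨ε, hε, hball⟩ := Metric.isOpen_iff.1 hτ.isOpen_regularTimes t ht
  have hK : Metric.closedBall t (ε / 2) ⊆ regularTimes τ :=
    (Metric.closedBall_subset_ball (by linarith)).trans hball
  have hrφ : ContinuousOn (fun x => S.r x * φ x) (Icc 0 1) := S.r_continuousOn.mul hφ
  have hF'c : ContinuousOn (fun z : ℝ × ℝ => S.r z.2 * φ z.2 * U z)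
      (Metric.closedBall t (ε / 2) ×ˢ Icc (0 : ℝ) 1) :=
    (hrφ.comp continuousOn_snd fun z hz => hz.2).mul (hUc.mono (prod_mono_left hK))
  obtain ⟨M, hM⟩ := ((isCompact_closedBall t (ε / 2)).prod isCompact_Icc).exists_bound_of_continuousOn
    hF'c
  have hsec : ∀ s ∈ Metric.closedBall t (ε / 2),
      ContinuousOn (fun x => S.r x * φ x * U (s, x)) (Icc 0 1) := fun s hs =>
    hF'c.comp (f := fun x => (s, x)) (continuousOn_const.prodMk continuousOn_id)
      fun x hx => ⟨hs, hx⟩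
  have hF : ∀ s ∈ regularTimes τ, ContinuousOn (fun x => S.r x * φ x * u s x) (Icc 0 1) :=
    fun s hs => hrφ.mul (hu.contDiffOn_profile s (hτ.pos_of_mem hs)).continuousOn
  have hI : uIoc (0 : ℝ) 1 ⊆ Icc 0 1 := by rw [uIoc_of_le zero_le_one]; exact Ioc_subset_Icc_self
  have hct : t ∈ Metric.closedBall t (ε / 2) := Metric.mem_closedBall_self (by linarith)
  have key := (intervalIntegral.hasDerivAt_integral_of_dominated_loc_of_deriv_le (μ := volume)
    (F := fun s x => S.r x * φ x * u s x) (F' := fun s x => S.r x * φ x * U (s, x))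
    (a := 0) (b := 1) (x₀ := t) (bound := fun _ => M)
    (Metric.closedBall_mem_nhds t (half_pos hε)) ?_ ?_ ?_ ?_ ?_ ?_).2
  · convert! key using 1
    refine intervalIntegral.integral_congr fun x hx => ?_
    rw [uIcc_of_le zero_le_one] at hx
    simp only [(hU t ht x hx).deriv]
  · filter_upwards [hτ.isOpen_regularTimes.mem_nhds ht] with s hs
    exact ((hF s hs).mono hI).aestronglyMeasurable measurableSet_uIoc
  · exact ContinuousOn.intervalIntegrable (by rw [uIcc_of_le zero_le_one]; exact hF t ht)
  · exact ((hsec t hct).mono hI).aestronglyMeasurable measurableSet_uIoc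
  · exact Eventually.of_forall fun x hx s hs => hM (s, x) ⟨hs, hI hx⟩
  · exact intervalIntegrable_const
  · exact Eventually.of_forall fun x hx s hs => (hU s (hK hs) x (hI hx)).const_mul _

/-- The coefficient of `u` with respect to an eigenfunction satisfies a scalar linear equation. -/
theorem integral_mul_deriv (hu : S.IsSolutionWith τ u₀ f d₀ d₁ u) (hτ : IsTimeSequence τ)
    (hf : S.IsGDWith τ f) {lam : ℕ → ℝ} {φ : ℕ → ℝ → ℝ} (hsys : S.IsEigensystem lam φ) (n : ℕ)
    {t : ℝ} (ht : t ∈ regularTimes τ) :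
    ∫ x in (0 : ℝ)..1, S.r x * φ n x * deriv (fun s => u s x) t =
      (∫ x in (0 : ℝ)..1, S.r x * φ n x * f t x)
        - lam n * (∫ x in (0 : ℝ)..1, S.r x * φ n x * u t x)
        + S.p 0 * S.trace₀ (φ n) * d₀ t - S.p 1 * S.trace₁ (φ n) * d₁ t := by
  have hut := hu.contDiffOn_profile t (hτ.pos_of_mem ht)
  have hrφ : ContinuousOn (fun x => S.r x * φ n x) (Icc 0 1) :=
    S.r_continuousOn.mul (hsys.contDiffOn n).continuousOn
  have hint : ∀ {g : ℝ → ℝ}, ContinuousOn g (Icc 0 1) →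
      IntervalIntegrable (fun x => S.r x * φ n x * g x) volume 0 1 := fun hg =>
    ContinuousOn.intervalIntegrable (by rw [uIcc_of_le zero_le_one]; exact hrφ.mul hg)
  have e : ∫ x in (0 : ℝ)..1, S.r x * φ n x * deriv (fun s => u s x) t =
      ∫ x in (0 : ℝ)..1, (S.r x * φ n x * f t x - S.r x * φ n x * S.A (u t) x) := by
    rw [intervalIntegral.integral_of_le zero_le_one, intervalIntegral.integral_of_le zero_le_one,
      -- The differential equation is available only on the open interval; the end point has measure
      -- zero.
      integral_Ioc_eq_integral_Ioo, integral_Ioc_eq_integral_Ioo]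
    refine setIntegral_congr_fun measurableSet_Ioo fun x hx => ?_
    simp only [← hu.pde t ht x hx]
    ring
  rw [e, intervalIntegral.integral_sub (hint (hf.continuousOn hτ ht)) (hint (continuousOn_A hut)),
    hsys.integral_mul_A n hut, hu.boundary0 t ht, hu.boundary1 t ht]
  ring

end IsSolutionWith

end SLData

/-! ### The decay estimate -/

theorem integral_exp_neg_le {a t : ℝ} (ha : 0 < a) :
    ∫ s in (0 : ℝ)..t, Real.exp (-a * (t - s)) ≤ 1 / a := by
  have hd : ∀ s : ℝ, HasDerivAt (fun s => Real.exp (-a * (t - s)) / a)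
      (Real.exp (-a * (t - s))) s := by
    intro s
    have h := (((hasDerivAt_id s).const_sub t).const_mul (-a)).exp.div_const a
    convert! h using 1
    simp only [id]
    field_simp
  rw [intervalIntegral.integral_eq_sub_of_hasDerivAt (fun s _ => hd s)
    (Continuous.intervalIntegrable (by fun_prop) _ _)]
  have := Real.exp_pos (-a * (t - 0))
  rw [sub_self, mul_zero, Real.exp_zero]
  have h2 : 0 ≤ Real.exp (-a * (t - 0)) / a := by positivity
  linarith

theorem sum_mul_le_of_sq_le {N : ℕ} {w z : ℕ → ℝ} {C : ℝ} (hC : 0 ≤ C)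
    (hz : ∑ n ∈ Finset.range N, z n ^ 2 ≤ C ^ 2) :
    ∑ n ∈ Finset.range N, |w n| * |z n| ≤ Real.sqrt (∑ n ∈ Finset.range N, w n ^ 2) * C := by
  refine (Real.sum_mul_le_sqrt_mul_sqrt _ _ _).trans ?_
  simp only [sq_abs]
  exact mul_le_mul_of_nonneg_left ((Real.sqrt_le_left hC).2 hz) (Real.sqrt_nonneg _)

/-- A bound for the weighted integral of a modal forcing term. -/
theorem sum_integral_exp_le {N : ℕ} {lam w β : ℕ → ℝ} {σ t C D : ℝ} (hlam : ∀ n, lam 0 ≤ lam n)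
    (hσ0 : 0 ≤ σ) (hσ : σ < lam 0) (hC : 0 ≤ C) (hD : 0 ≤ D)
    (hβ : ∑ n ∈ Finset.range N, (|β n| / lam n) ^ 2 ≤ C ^ 2) :
    ∑ n ∈ Finset.range N, |w n| * |β n| * D * ∫ s in (0 : ℝ)..t, Real.exp (-(lam n - σ) * (t - s)) ≤
      Real.sqrt (∑ n ∈ Finset.range N, w n ^ 2) * (lam 0 / (lam 0 - σ) * C * D) := by
  have hl0 : 0 < lam 0 := hσ0.trans_lt hσ
  have key : ∀ n ∈ Finset.range N,
      |w n| * |β n| * D * ∫ s in (0 : ℝ)..t, Real.exp (-(lam n - σ) * (t - s)) ≤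
      lam 0 / (lam 0 - σ) * D * (|w n| * |(|β n| / lam n)|) := by
    intro n _
    have hln : 0 < lam n := hl0.trans_le (hlam n)
    have hn : 0 < lam n - σ := by linarith [hlam n]
    have h0 : 0 < lam 0 - σ := by linarith
    -- After clearing denominators this is σ (λₙ - λ₀) ≥ 0. It is the origin of the factor λ₀/(λ₀ -
    -- σ), and it retains the 1/λₙ needed for the ℓ² bound.
    have h1 : 1 / (lam n - σ) ≤ lam 0 / (lam 0 - σ) * (1 / lam n) := by
      rw [div_mul_div_comm, mul_one, div_le_div_iff₀ hn (by positivity)]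
      nlinarith [mul_nonneg hσ0 (sub_nonneg.2 (hlam n))]
    have h2 := (integral_exp_neg_le (t := t) hn).trans h1
    rw [abs_of_nonneg (div_nonneg (abs_nonneg (β n)) hln.le)]
    refine (mul_le_mul_of_nonneg_left h2 (by positivity)).trans (le_of_eq ?_)
    ring
  refine (Finset.sum_le_sum key).trans ?_
  rw [← Finset.mul_sum]
  have h3 := sum_mul_le_of_sq_le (w := w) hC hβ
  have h4 : 0 ≤ lam 0 / (lam 0 - σ) * D :=
    mul_nonneg (div_nonneg hl0.le (by linarith)) hD
  refine (mul_le_mul_of_nonneg_left h3 h4).trans (le_of_eq ?_)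
  ring

theorem bddAbove_weighted {F : ℝ → ℝ} {σ t : ℝ} (hσ : 0 ≤ σ) (hF0 : ∀ s, 0 ≤ F s)
    (hF : ∃ M, ∀ s ∈ Ioo 0 t, F s ≤ M) :
    BddAbove (range fun s : Ioo 0 t => F s * Real.exp (-σ * (t - s))) := by
  obtain ⟨M, hM⟩ := hF
  refine ⟨M, ?_⟩
  rintro _ ⟨s, rfl⟩
  refine (mul_le_of_le_one_right (hF0 s) (Real.exp_le_one_iff.2 ?_)).trans (hM s s.2)
  have := s.2.2
  nlinarith [mul_nonneg hσ (sub_nonneg.2 this.le)]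

theorem le_iSup_mul_exp {F : ℝ → ℝ} {σ t : ℝ}
    (hb : BddAbove (range fun s : Ioo 0 t => F s * Real.exp (-σ * (t - s)))) {s : ℝ}
    (hs : s ∈ Ioo 0 t) :
    F s ≤ (⨆ s : Ioo 0 t, F s * Real.exp (-σ * (t - s))) * Real.exp (σ * (t - s)) := by
  have h := le_ciSup hb ⟨s, hs⟩
  calc F s = F s * Real.exp (-σ * (t - s)) * Real.exp (σ * (t - s)) := by
        rw [mul_assoc, ← Real.exp_add]; simp
    _ ≤ _ := mul_le_mul_of_nonneg_right h (Real.exp_pos _).le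

/-! ### Integrated modal equations and the estimate of the norm -/

namespace SLData

variable {S : SLData} {τ : ℕ → ℝ} {f : ℝ → ℝ → ℝ} {u₀ d₀ d₁ : ℝ → ℝ} {u : ℝ → ℝ → ℝ}
  {lam : ℕ → ℝ} {φ : ℕ → ℝ → ℝ}

/-- The forcing term of the `n`-th modal equation. -/
def modalForcing (S : SLData) (φ : ℕ → ℝ → ℝ) (f : ℝ → ℝ → ℝ) (d₀ d₁ : ℝ → ℝ) (n : ℕ) (s : ℝ) : ℝ :=
  (∫ x in (0 : ℝ)..1, S.r x * φ n x * f s x) + S.p 0 * S.trace₀ (φ n) * d₀ s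
    - S.p 1 * S.trace₁ (φ n) * d₁ s

namespace IsSolutionWith

/-- Variation of constants for the modal equations. -/
theorem coeff_eq (hu : S.IsSolutionWith τ u₀ f d₀ d₁ u) (hτ : IsTimeSequence τ)
    (hf : S.IsGDWith τ f) (hd₀ : IsGBWith τ d₀) (hd₁ : IsGBWith τ d₁)
    (hsys : S.IsEigensystem lam φ) (n : ℕ) {t : ℝ} (ht : 0 < t) :
    IntervalIntegrable (fun s => Real.exp (-lam n * (t - s)) * S.modalForcing φ f d₀ d₁ n s)
      volume 0 t ∧
    ∫ x in (0 : ℝ)..1, S.r x * φ n x * u t x =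
      Real.exp (-lam n * t) * (∫ x in (0 : ℝ)..1, S.r x * φ n x * u 0 x) +
        ∫ s in (0 : ℝ)..t, Real.exp (-lam n * (t - s)) * S.modalForcing φ f d₀ d₁ n s := by
  set c : ℝ → ℝ := fun s => ∫ x in (0 : ℝ)..1, S.r x * φ n x * u s x with hc
  set G : ℝ → ℝ := fun s => Real.exp (-lam n * (t - s)) * S.modalForcing φ f d₀ d₁ n s with hG
  have hreg : ∀ s ∈ Ioo 0 t \ range τ, s ∈ regularTimes τ := fun s hs => ⟨hs.1.1.le, hs.2⟩
  have hcnt : (range τ).Countable := countable_range τ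
  have hderiv : ∀ s ∈ Ioo 0 t \ range τ,
      HasDerivAt (fun s => Real.exp (-lam n * (t - s)) * c s) (G s) s := by
    intro s hs
    have h1 := hu.hasDerivAt_coeff hτ (hsys.contDiffOn n).continuousOn (hreg s hs)
    rw [hu.integral_mul_deriv hτ hf hsys n (hreg s hs)] at h1
    have h2 := (((hasDerivAt_id s).const_sub t).const_mul (-lam n)).exp
    convert! h2.mul h1 using 1
    simp only [hG, modalForcing, id]
    ring
  have hae : ∀ᵐ s ∂(volume.restrict (Ioo 0 t)), s ∈ Ioo 0 t \ range τ := by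
    filter_upwards [ae_restrict_mem measurableSet_Ioo,
      ae_restrict_of_ae (hcnt.ae_notMem volume)] with s h1 h2
    exact ⟨h1, h2⟩
  have hint : IntervalIntegrable G volume 0 t := by
    rw [intervalIntegrable_iff_integrableOn_Ioo_of_le ht.le]
    obtain ⟨M₀, hM₀⟩ := hd₀.exists_bound hτ t
    obtain ⟨M₁, hM₁⟩ := hd₁.exists_bound hτ t
    obtain ⟨M, hM⟩ := hf.exists_bound hτ t
    have hexp : ∀ s ∈ Ioo 0 t, Real.exp (-lam n * (t - s)) ≤ Real.exp (|lam n| * t) := by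
      intro s hs
      refine Real.exp_le_exp.2 ?_
      have h1 : -lam n * (t - s) ≤ |lam n| * (t - s) :=
        mul_le_mul_of_nonneg_right (neg_le_abs _) (by linarith [hs.2])
      have h2 : |lam n| * (t - s) ≤ |lam n| * t :=
        mul_le_mul_of_nonneg_left (by linarith [hs.1]) (abs_nonneg _)
      linarith
    refine Integrable.of_bound ?_ (Real.exp (|lam n| * t) *
      (M + |S.p 0 * S.trace₀ (φ n)| * M₀ + |S.p 1 * S.trace₁ (φ n)| * M₁)) ?_
    · refine (stronglyMeasurable_deriv fun s =>
        Real.exp (-lam n * (t - s)) * c s).aestronglyMeasurable.congr ?_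
      filter_upwards [hae] with s hs
      exact (hderiv s hs).deriv
    · filter_upwards [hae] with s hs
      have hfs := memL2_of_continuousOn (S := S) (hf.continuousOn hτ (hreg s hs))
      have h1 := (abs_integral_mul_le (hsys.memL2 n) hfs).trans_eq
        (by rw [hsys.normalized n, one_mul])
      have h2 := h1.trans (hM s hs.1)
      have h3 := mul_le_mul_of_nonneg_left (hM₀ s hs.1) (abs_nonneg (S.p 0 * S.trace₀ (φ n)))
      have h4 := mul_le_mul_of_nonneg_left (hM₁ s hs.1) (abs_nonneg (S.p 1 * S.trace₁ (φ n)))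
      rw [← abs_mul] at h3 h4
      rw [hG, Real.norm_eq_abs, abs_mul, abs_of_pos (Real.exp_pos _)]
      refine mul_le_mul (hexp s hs.1) ?_ (abs_nonneg _) (Real.exp_pos _).le
      unfold modalForcing
      refine (abs_sub _ _).trans ((add_le_add ((abs_add_le _ _).trans (add_le_add h2 h3)) h4))
  refine ⟨hint, ?_⟩
  have hcont : ContinuousOn (fun s => Real.exp (-lam n * (t - s)) * c s) (Icc 0 t) :=
    (Continuous.continuousOn (by fun_prop)).mul
      ((hu.continuousOn_coeff (hsys.memL2 n)).mono fun s hs => hs.1)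
  -- Continuity in L²_r makes the coefficient continuous on [0, t], including 0 and the τᵢ, so a
  -- countable set of times without derivative is harmless.
  rw [integral_eq_of_hasDerivAt_off_countable_of_le _ G ht.le hcnt hcont hderiv hint]
  simp [hc]

/-- With X² the sum of cₙ(t)² over n < N, one factor cₙ(t) is kept as a weight and the other is
replaced by its variation of constants formula. Every resulting term is at most X times a term of
the right-hand side R, so X² ≤ X R and X ≤ R uniformly in N. -/
theorem norm_le (hu : S.IsSolutionWith τ u₀ f d₀ d₁ u) (hτ : IsTimeSequence τ)
    (hf : S.IsGDWith τ f) (hd₀ : IsGBWith τ d₀) (hd₁ : IsGBWith τ d₁)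
    (hsys : S.IsEigensystem lam φ) (hpos : 0 < lam 0)
    (hs₀ : Summable (S.gainTerm₀ lam φ)) (hs₁ : Summable (S.gainTerm₁ lam φ))
    {σ : ℝ} (hσ0 : 0 ≤ σ) (hσ : σ < lam 0) {t : ℝ} (ht : 0 < t) {D₀ D₁ F : ℝ}
    (hD₀ : 0 ≤ D₀) (hD₁ : 0 ≤ D₁) (hF : 0 ≤ F)
    (hb₀ : ∀ s ∈ Ioo 0 t, |d₀ s| ≤ D₀ * Real.exp (σ * (t - s)))
    (hb₁ : ∀ s ∈ Ioo 0 t, |d₁ s| ≤ D₁ * Real.exp (σ * (t - s)))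
    (hbf : ∀ s ∈ Ioo 0 t, S.norm (f s) ≤ F * Real.exp (σ * (t - s))) :
    S.norm (u t) ≤ Real.exp (-lam 0 * t) * S.norm u₀ + lam 0 / (lam 0 - σ) * S.C₀ lam φ * D₀
      + lam 0 / (lam 0 - σ) * S.C₁ lam φ * D₁ + 1 / (lam 0 - σ) * F := by
  have h0σ : 0 < lam 0 - σ := by linarith
  have hmono : ∀ n, lam 0 ≤ lam n := fun n => hsys.strictMono.monotone (Nat.zero_le n)
  have hC₀ : 0 ≤ S.C₀ lam φ := IsEigensystem.C₀_nonneg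
  have hC₁ : 0 ≤ S.C₁ lam φ := IsEigensystem.C₁_nonneg
  set c : ℕ → ℝ → ℝ := fun n s => ∫ x in (0 : ℝ)..1, S.r x * φ n x * u s x with hc
  set R := Real.exp (-lam 0 * t) * S.norm u₀ + lam 0 / (lam 0 - σ) * S.C₀ lam φ * D₀
      + lam 0 / (lam 0 - σ) * S.C₁ lam φ * D₁ + 1 / (lam 0 - σ) * F with hR
  have hu₀ : S.norm (u 0) = S.norm u₀ := norm_congr hu.initial
  have hR0 : 0 ≤ R := by
    have := norm_nonneg' (S := S) u₀
    positivity
  have hfin : ∀ N : ℕ, ∑ n ∈ Finset.range N, c n t ^ 2 ≤ R ^ 2 := by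
    intro N
    set w : ℕ → ℝ := fun n => c n t with hw
    set X := Real.sqrt (∑ n ∈ Finset.range N, w n ^ 2) with hX
    have hXsq : X ^ 2 = ∑ n ∈ Finset.range N, w n ^ 2 :=
      Real.sq_sqrt (Finset.sum_nonneg fun n _ => sq_nonneg _)
    have hX0 : 0 ≤ X := Real.sqrt_nonneg _
    have hbessel : ∀ {g : ℝ → ℝ}, S.MemL2 g →
        ∑ n ∈ Finset.range N, (∫ x in (0 : ℝ)..1, S.r x * φ n x * g x) ^ 2 ≤ S.norm g ^ 2 :=
      fun hg => sum_le_hasSum _ (fun n _ => sq_nonneg _) (hsys.hasSum_coeff_sq hpos hg)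
    have hrep : ∑ n ∈ Finset.range N, w n ^ 2 =
        (∑ n ∈ Finset.range N, w n * (Real.exp (-lam n * t) * c n 0)) +
        ∫ s in (0 : ℝ)..t, ∑ n ∈ Finset.range N,
          w n * (Real.exp (-lam n * (t - s)) * S.modalForcing φ f d₀ d₁ n s) := by
      rw [intervalIntegral.integral_finsetSum fun n _ =>
        (hu.coeff_eq hτ hf hd₀ hd₁ hsys n ht).1.const_mul _, ← Finset.sum_add_distrib]
      refine Finset.sum_congr rfl fun n _ => ?_
      rw [intervalIntegral.integral_const_mul, ← mul_add, sq]
      congr 1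
      exact (hu.coeff_eq hτ hf hd₀ hd₁ hsys n ht).2
    have hinit : ∑ n ∈ Finset.range N, w n * (Real.exp (-lam n * t) * c n 0) ≤
        X * (Real.exp (-lam 0 * t) * S.norm u₀) := by
      have h1 := sum_mul_le_of_sq_le (w := w) (norm_nonneg' (S := S) (u 0))
        (hbessel (hu.memL2 0 le_rfl))
      calc _ ≤ ∑ n ∈ Finset.range N, Real.exp (-lam 0 * t) * (|w n| * |c n 0|) := by
            refine Finset.sum_le_sum fun n _ => ?_
            have h2 : Real.exp (-lam n * t) ≤ Real.exp (-lam 0 * t) :=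
              Real.exp_le_exp.2 (by nlinarith [hmono n])
            calc w n * (Real.exp (-lam n * t) * c n 0)
                ≤ |w n * (Real.exp (-lam n * t) * c n 0)| := le_abs_self _
              _ = Real.exp (-lam n * t) * (|w n| * |c n 0|) := by
                rw [abs_mul, abs_mul, abs_of_pos (Real.exp_pos _)]; ring
              _ ≤ _ := mul_le_mul_of_nonneg_right h2 (by positivity)
        _ = Real.exp (-lam 0 * t) * ∑ n ∈ Finset.range N, |w n| * |c n 0| := by
            rw [Finset.mul_sum]
        _ ≤ Real.exp (-lam 0 * t) * (X * S.norm (u 0)) :=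
            mul_le_mul_of_nonneg_left h1 (Real.exp_pos _).le
        _ = _ := by rw [hu₀]; ring
    -- The boundary parts keep the individual rates λₙ - σ, since a common rate would lose the
    -- factors 1/λₙ; the part of f uses λ₀ - σ after Cauchy-Schwarz in n.
    set B : ℝ → ℝ := fun s =>
      ((∑ n ∈ Finset.range N, |w n| * |S.p 0 * S.trace₀ (φ n)| * D₀ *
          Real.exp (-(lam n - σ) * (t - s))) +
        ∑ n ∈ Finset.range N, |w n| * |S.p 1 * S.trace₁ (φ n)| * D₁ *
          Real.exp (-(lam n - σ) * (t - s))) +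
      X * F * Real.exp (-(lam 0 - σ) * (t - s)) with hB
    have hpt : ∀ s ∈ Ioo 0 t \ range τ, ∑ n ∈ Finset.range N,
        w n * (Real.exp (-lam n * (t - s)) * S.modalForcing φ f d₀ d₁ n s) ≤ B s := by
      intro s hs
      have hfs := memL2_of_continuousOn (S := S) (hf.continuousOn hτ (t := s) ⟨hs.1.1.le, hs.2⟩)
      have hst : 0 ≤ t - s := by linarith [hs.1.2]
      have hsplit : ∀ a : ℝ, Real.exp (-(a - σ) * (t - s)) =
          Real.exp (-a * (t - s)) * Real.exp (σ * (t - s)) := fun a => by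
        rw [← Real.exp_add]; congr 1; ring
      have hterm : ∀ (β d D : ℝ) (n : ℕ), |d| ≤ D * Real.exp (σ * (t - s)) →
          w n * (Real.exp (-lam n * (t - s)) * (β * d)) ≤
            |w n| * |β| * D * Real.exp (-(lam n - σ) * (t - s)) := by
        intro β d D n hd
        calc w n * (Real.exp (-lam n * (t - s)) * (β * d))
            ≤ |w n * (Real.exp (-lam n * (t - s)) * (β * d))| := le_abs_self _
          _ = |w n| * |β| * Real.exp (-lam n * (t - s)) * |d| := by
            rw [abs_mul, abs_mul, abs_mul, abs_of_pos (Real.exp_pos _)]; ring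
          _ ≤ |w n| * |β| * Real.exp (-lam n * (t - s)) * (D * Real.exp (σ * (t - s))) :=
            mul_le_mul_of_nonneg_left hd (by positivity)
          _ = _ := by rw [hsplit]; ring
      have hfterm : ∑ n ∈ Finset.range N, w n * (Real.exp (-lam n * (t - s)) *
          ∫ x in (0 : ℝ)..1, S.r x * φ n x * f s x) ≤
          X * F * Real.exp (-(lam 0 - σ) * (t - s)) := by
        have h1 := sum_mul_le_of_sq_le (w := w) (norm_nonneg' (S := S) (f s)) (hbessel hfs)
        calc _ ≤ ∑ n ∈ Finset.range N, Real.exp (-lam 0 * (t - s)) *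
              (|w n| * |∫ x in (0 : ℝ)..1, S.r x * φ n x * f s x|) := by
              refine Finset.sum_le_sum fun n _ => ?_
              have h2 : Real.exp (-lam n * (t - s)) ≤ Real.exp (-lam 0 * (t - s)) :=
                Real.exp_le_exp.2 (by nlinarith [hmono n])
              refine (le_abs_self _).trans ?_
              rw [abs_mul, abs_mul, abs_of_pos (Real.exp_pos _), mul_left_comm]
              exact mul_le_mul_of_nonneg_right h2 (by positivity)
          _ = Real.exp (-lam 0 * (t - s)) *
              ∑ n ∈ Finset.range N, |w n| * |∫ x in (0 : ℝ)..1, S.r x * φ n x * f s x| := by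
              rw [Finset.mul_sum]
          _ ≤ Real.exp (-lam 0 * (t - s)) * (X * (F * Real.exp (σ * (t - s)))) :=
              mul_le_mul_of_nonneg_left
                (h1.trans (mul_le_mul_of_nonneg_left (hbf s hs.1) hX0)) (Real.exp_pos _).le
          _ = _ := by rw [hsplit]; ring
      rw [hB]
      -- The minus sign is moved onto d₁, so that both boundary terms fall under `hterm`.
      have e : ∀ n, w n * (Real.exp (-lam n * (t - s)) * S.modalForcing φ f d₀ d₁ n s) =
          w n * (Real.exp (-lam n * (t - s)) * (S.p 0 * S.trace₀ (φ n) * d₀ s)) +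
          w n * (Real.exp (-lam n * (t - s)) * (S.p 1 * S.trace₁ (φ n) * (-d₁ s))) +
          w n * (Real.exp (-lam n * (t - s)) * ∫ x in (0 : ℝ)..1, S.r x * φ n x * f s x) := by
        intro n
        unfold modalForcing
        ring
      simp only [e, Finset.sum_add_distrib]
      refine add_le_add (add_le_add ?_ ?_) hfterm
      · exact Finset.sum_le_sum fun n _ => hterm _ _ _ n (hb₀ s hs.1)
      · exact Finset.sum_le_sum fun n _ => hterm _ _ _ n (by rw [abs_neg]; exact hb₁ s hs.1)
    have hintB : ∫ s in (0 : ℝ)..t, B s ≤ X * (lam 0 / (lam 0 - σ) * S.C₀ lam φ * D₀) +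
        X * (lam 0 / (lam 0 - σ) * S.C₁ lam φ * D₁) + X * (1 / (lam 0 - σ) * F) := by
      have hexpi : ∀ a : ℝ, IntervalIntegrable (fun s => Real.exp (-a * (t - s))) volume 0 t :=
        fun a => Continuous.intervalIntegrable (by fun_prop) _ _
      have hsumi : ∀ k : ℕ → ℝ, IntervalIntegrable (fun s => ∑ n ∈ Finset.range N,
          k n * Real.exp (-(lam n - σ) * (t - s))) volume 0 t :=
        fun k => Continuous.intervalIntegrable (by fun_prop) _ _
      rw [hB, intervalIntegral.integral_add ((hsumi _).add (hsumi _)) ((hexpi _).const_mul _),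
        intervalIntegral.integral_add (hsumi _) (hsumi _),
        intervalIntegral.integral_finsetSum fun n _ => (hexpi _).const_mul _,
        intervalIntegral.integral_finsetSum fun n _ => (hexpi _).const_mul _]
      simp only [intervalIntegral.integral_const_mul]
      refine add_le_add (add_le_add ?_ ?_) ?_
      · exact sum_integral_exp_le hmono hσ0 hσ hC₀ hD₀ (IsEigensystem.sum_trace₀_sq_le hs₀ N)
      · exact sum_integral_exp_le hmono hσ0 hσ hC₁ hD₁ (IsEigensystem.sum_trace₁_sq_le hs₁ N)
      · refine (mul_le_mul_of_nonneg_left (integral_exp_neg_le h0σ)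
          (mul_nonneg hX0 hF)).trans (le_of_eq ?_)
        ring
    have hle : ∫ s in (0 : ℝ)..t, ∑ n ∈ Finset.range N,
        w n * (Real.exp (-lam n * (t - s)) * S.modalForcing φ f d₀ d₁ n s) ≤
        ∫ s in (0 : ℝ)..t, B s := by
      rw [intervalIntegral.integral_of_le ht.le, intervalIntegral.integral_of_le ht.le,
        integral_Ioc_eq_integral_Ioo, integral_Ioc_eq_integral_Ioo]
      have i1 : IntervalIntegrable (fun s => ∑ n ∈ Finset.range N,
          w n * (Real.exp (-lam n * (t - s)) * S.modalForcing φ f d₀ d₁ n s)) volume 0 t := by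
        have := IntervalIntegrable.sum (Finset.range N) (f := fun n s =>
          w n * (Real.exp (-lam n * (t - s)) * S.modalForcing φ f d₀ d₁ n s)) fun n _ =>
          (hu.coeff_eq hτ hf hd₀ hd₁ hsys n ht).1.const_mul (w n)
        convert! this using 1
        ext s
        simp
      have i2 : IntervalIntegrable B volume 0 t :=
        Continuous.intervalIntegrable (by rw [hB]; fun_prop) _ _
      refine integral_mono_ae ((intervalIntegrable_iff_integrableOn_Ioo_of_le ht.le).1 i1)
        ((intervalIntegrable_iff_integrableOn_Ioo_of_le ht.le).1 i2) ?_
      filter_upwards [ae_restrict_mem measurableSet_Ioo,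
        ae_restrict_of_ae ((countable_range τ).ae_notMem volume)] with s h1 h2
      exact hpt s ⟨h1, h2⟩
    have hXR : X ^ 2 ≤ X * R := by
      rw [hXsq, hrep, hR]
      linarith [hinit, hle, hintB]
    have hXle : X ≤ R := by
      rcases hX0.eq_or_lt with h | h
      · rw [← h]; exact hR0
      · rw [sq] at hXR
        exact le_of_mul_le_mul_left hXR h
    calc ∑ n ∈ Finset.range N, c n t ^ 2 = X ^ 2 := hXsq.symm
      _ ≤ R ^ 2 := pow_le_pow_left₀ hX0 hXle 2
  -- By Parseval the partial sums, all bounded by R², converge to the squared norm of u[t].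
  have hlim := (hsys.hasSum_coeff_sq hpos (hu.memL2 t ht.le)).tendsto_sum_nat
  exact abs_le_of_sq_le_sq' (le_of_tendsto' hlim hfin) hR0 |>.2

end IsSolutionWith

end SLData

end

/-! ### The theorem -/

theorem theorem2p4 (S : SLData) (lam : ℕ → ℝ) (φ : ℕ → ℝ → ℝ)
    (hsys : S.IsEigensystem lam φ) (hH : AssumptionH lam φ) (hES : 0 < lam 0) :
    -- the gains: convergence of the series, and the representation by stationary problems
    Summable (S.gainTerm₀ lam φ) ∧ Summable (S.gainTerm₁ lam φ) ∧
    (∃ v : ℝ → ℝ, S.IsUniqueBVPSolution (Real.sqrt (S.b₁ ^ 2 + S.b₂ ^ 2)) 0 v ∧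
      S.C₀ lam φ = 1 / Real.sqrt (S.b₁ ^ 2 + S.b₂ ^ 2) * S.norm v) ∧
    (∃ w : ℝ → ℝ, S.IsUniqueBVPSolution 0 (Real.sqrt (S.a₁ ^ 2 + S.a₂ ^ 2)) w ∧
      S.C₁ lam φ = 1 / Real.sqrt (S.a₁ ^ 2 + S.a₂ ^ 2) * S.norm w) ∧
    -- the estimate, whose suprema are finite
    ∀ (u₀ : ℝ → ℝ) (f : ℝ → ℝ → ℝ) (d₀ d₁ : ℝ → ℝ) (u : ℝ → ℝ → ℝ),
      S.MemL2 u₀ → S.IsGD f → IsGB d₀ → IsGB d₁ → S.IsSolution u₀ f d₀ d₁ u →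
      ∀ σ ∈ Set.Ico 0 (lam 0), ∀ t : ℝ, 0 < t →
        BddAbove (Set.range fun s : Set.Ioo 0 t => |d₀ s| * Real.exp (-σ * (t - s))) ∧
        BddAbove (Set.range fun s : Set.Ioo 0 t => |d₁ s| * Real.exp (-σ * (t - s))) ∧
        BddAbove (Set.range fun s : Set.Ioo 0 t => S.norm (f s) * Real.exp (-σ * (t - s))) ∧
        S.norm (u t) ≤ Real.exp (-lam 0 * t) * S.norm u₀
          + lam 0 / (lam 0 - σ) * S.C₀ lam φ *
              (⨆ s : Set.Ioo 0 t, |d₀ s| * Real.exp (-σ * (t - s)))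
          + lam 0 / (lam 0 - σ) * S.C₁ lam φ *
              (⨆ s : Set.Ioo 0 t, |d₁ s| * Real.exp (-σ * (t - s)))
          + 1 / (lam 0 - σ) *
              (⨆ s : Set.Ioo 0 t, S.norm (f s) * Real.exp (-σ * (t - s))) := by
  have h0 := hsys.not_isEigenvalue_zero hES
  obtain ⟨v, hv⟩ := SLData.exists_isUniqueBVPSolution h0 (Real.sqrt (S.b₁ ^ 2 + S.b₂ ^ 2)) 0
  obtain ⟨w, hw⟩ := SLData.exists_isUniqueBVPSolution h0 0 (Real.sqrt (S.a₁ ^ 2 + S.a₂ ^ 2))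
  have hs₀ := (hsys.hasSum_gainTerm₀ hES hv.1).summable
  have hs₁ := (hsys.hasSum_gainTerm₁ hES hw.1).summable
  refine ⟨hs₀, hs₁, ⟨v, hv, hsys.C₀_eq hES hv.1⟩, ⟨w, hw, hsys.C₁_eq hES hw.1⟩, ?_⟩
  rintro u₀ f d₀ d₁ u - - - - ⟨τ, hτ, hf, hd₀, hd₁, hu⟩ σ ⟨hσ0, hσ⟩ t ht
  have hb₀ := bddAbove_weighted hσ0 (fun s => abs_nonneg (d₀ s)) (hd₀.exists_bound hτ t)
  have hb₁ := bddAbove_weighted hσ0 (fun s => abs_nonneg (d₁ s)) (hd₁.exists_bound hτ t)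
  -- At an exceptional time s where r f[s]² is not integrable, the integral in `SLData.norm` has the
  -- default value 0, so that time adds nothing to the supremum.
  have hbf := bddAbove_weighted hσ0 (fun s => SLData.norm_nonneg' (S := S) (f s))
    (hf.exists_bound hτ t)
  refine ⟨hb₀, hb₁, hbf, ?_⟩
  exact hu.norm_le hτ hf hd₀ hd₁ hsys hES hs₀ hs₁ hσ0 hσ ht
    (Real.iSup_nonneg fun s => by positivity) (Real.iSup_nonneg fun s => by positivity)
    (Real.iSup_nonneg fun s => mul_nonneg (SLData.norm_nonneg' _) (Real.exp_pos _).le)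
    (fun s hs => le_iSup_mul_exp (F := fun s => |d₀ s|) hb₀ hs)
    (fun s hs => le_iSup_mul_exp (F := fun s => |d₁ s|) hb₁ hs)
    (fun s hs => le_iSup_mul_exp (F := fun s => S.norm (f s)) hbf hs)
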